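/- Theorem (ANN approximation of the robust Q-function). Let $T\in\mathbb N$, $\mathcal T=\{0,\dots,T\}$. Let $\mathcal S\subset\mathbb R^{1+d}$ and $\mathcal A\subset\mathbb R^{m}$ be compact state and action spaces, where the first coordinate of a state is the time: it takes values in $\{0,\dots,T+1\}$, and $\mathcal S_t$ denotes the set of states with first coordinate $t$. Let the cost $c:\mathcal S\times\mathcal A\times\mathcal S\to\mathbb R$ be continuous, let the stationary transition law $\mathbb P(\cdot\mid s,a)$ depend weakly continuously on $(s,a)\in\mathcal S\times\mathcal A$ and satisfy $\mathbb P(\mathcal S_{t+1}\mid s,a)=1$ for $s\in\mathcal S_t$, $t\le T$, and let a continuous policy $\pi^\theta:\mathcal S\to\mathcal A$ (for instance an ANN) be fixed. For every $s\in\mathcal S$ let $\epsilon_s\ge 0$ be a tolerance and $\gamma_s:[0,1]\to[0,\infty)$ a square-integrable distortion density with $\int_0^1\gamma_s(u)\,du=1$ (for instance piecewise constant), such that $s\mapsto\epsilon_s$ is continuous and $s\mapsto\gamma_s\in L^2([0,1])$ is continuous. Write $\breve F_Y(u)=\inf\{z: F_Y(z)\ge u\}$ for the quantile function of $Y$, and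 $\langle\cdot,\cdot\rangle$, $\|\cdot\|$ for the inner product and norm of $L^2([0,1])$. For bounded $Z$ let $\varphi^{\epsilon}_Z$ be one of the two uncertainty sets (the same choice throughout) $$\{Y \text{ bounded}: \|\breve F_Z-\breve F_Y\|\le\epsilon\},\qquad \{Y\text{ bounded}: \|\breve F_Z-\breve F_Y\|\le\epsilon,\ \langle\breve F_Z,1\rangle=\langle\breve F_Y,1\rangle,\ \|\breve F_Z\|^2=\|\breve F_Y\|^2\}.$$ The robust Q-function of $\pi^\theta$ is defined by $Q_{T+1}=0$ and, for $t\in\mathcal T$, $$Q_t(s,a;\theta)=\sup_{Z^\phi_t\in\varphi^{\epsilon_s}_{Z^\theta_t}}\big\langle\gamma_s,\breve F_{Z_t^\phi}\big\rangle,\qquad Z_t^\theta=c(s,a,s_{t+1})+Q_{t+1}(s_{t+1},\pi^\theta(s_{t+1});\theta),$$ where all laws are conditional on $s_t=s$, $a_t=a$, i.e. $s_{t+1}\sim\mathbb P(\cdot\mid s,a)$, and the random variables $Z_t^\phi$ live on the one-step probability space of $(s_{t+1},U)$, with $U$ uniform on $[0,1]$ and independent of $s_{t+1}$. Then these suprema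 are over nonempty bounded sets, so $Q_t$ is well defined and real-valued on $\mathcal S\times\mathcal A$ for all $t\in\mathcal T$. Moreover, for every continuous non-polynomial activation function $\sigma:\mathbb R\to\mathbb R$ and every $\varepsilon>0$ there exists a single feed-forward ANN $Q^\psi:\mathbb R^{1+d}\times\mathbb R^m\to\mathbb R$ with activation $\sigma$ (affine layers of finite number and widths, $\sigma$ applied componentwise after each hidden layer) such that for all $t\in\mathcal T$ $$\sup_{(s,a)\in\mathcal S_t\times\mathcal A}\big|Q_t(s,a;\theta)-Q^\psi(s,a)\big|<\varepsilon .$$ -/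

import Mathlib

open MeasureTheory ProbabilityTheory

/-- Multilayer perceptrons with `n` real inputs and `k` real outputs, of arbitrary depth and
arbitrary widths, given by the weights and biases of their fully connected layers. -/
inductive MLP : ℕ → ℕ → Type
  /-- The output layer (affine). -/
  | output {n k : ℕ} (W : Matrix (Fin k) (Fin n) ℝ) (b : Fin k → ℝ) : MLP n k
  /-- A hidden layer with `h` nodes, followed by the rest of the network. -/
  | hidden {n h k : ℕ} (W : Matrix (Fin h) (Fin n) ℝ) (b : Fin h → ℝ) (N : MLP h k) : MLP n k

/-- The function computed by a network with activation function `σ`, which is applied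
componentwise after every hidden layer. -/
def MLP.eval (σ : ℝ → ℝ) : {n k : ℕ} → MLP n k → (Fin n → ℝ) → (Fin k → ℝ)
  | _, _, .output W b, x => W.mulVec x + b
  | _, _, .hidden W b N, x => MLP.eval σ N (fun i => σ ((W.mulVec x + b) i))

noncomputable section

/-- The (left-continuous) quantile function of a probability law on the real line,
`u ↦ inf {z : F(z) ≥ u}` for `u` in `(0, 1)`. -/
def quantile (ν : Measure ℝ) (u : ℝ) : ℝ :=
  sInf {z : ℝ | u ≤ cdf ν z}

/-- The inner product of `L²([0, 1])`. -/
def innerL2 (f g : ℝ → ℝ) : ℝ :=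
  ∫ u in (0 : ℝ)..1, f u * g u

/-- The norm of `L²([0, 1])`. -/
def normL2 (f : ℝ → ℝ) : ℝ :=
  Real.sqrt (innerL2 f f)

/-- `γ` is the (square integrable) density of a distortion risk measure:
it is nonnegative on `[0, 1]` and integrates to one. -/
def IsDistortionDensity (γ : ℝ → ℝ) : Prop :=
  MemLp γ 2 (volume.restrict (Set.Icc (0 : ℝ) 1)) ∧
    (∀ u ∈ Set.Icc (0 : ℝ) 1, 0 ≤ γ u) ∧
    ∫ u in (0 : ℝ)..1, γ u = 1

/-- The two kinds of uncertainty sets: a Wasserstein ball, and a Wasserstein ball with constraints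
on the first two moments. -/
inductive UncertaintyKind
  | wasserstein
  | wassersteinMoments

/-- The uncertainty set of tolerance `ε` around the random variable `Z` on the probability space
`(Ω, P)`: bounded random variables on the same space whose quantile function is within
`L²`-distance `ε` of that of `Z` and, for the second kind, has the same first two moments. -/
def uncertaintySet {Ω : Type*} [MeasurableSpace Ω] (P : Measure Ω) (k : UncertaintyKind)
    (ε : ℝ) (Z : Ω → ℝ) : Set (Ω → ℝ) :=
  {Y | Measurable Y ∧ (∃ C : ℝ, ∀ ω, |Y ω| ≤ C) ∧
    normL2 (fun u => quantile (P.map Z) u - quantile (P.map Y) u) ≤ ε ∧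
    match k with
    | .wasserstein => True
    | .wassersteinMoments =>
        innerL2 (quantile (P.map Z)) 1 = innerL2 (quantile (P.map Y)) 1 ∧
        normL2 (quantile (P.map Z)) ^ 2 = normL2 (quantile (P.map Y)) ^ 2}

/-- The distortion risks `⟨γ, F̆_Y⟩` of the random variables `Y` in the uncertainty set of `Z`. -/
def distortionRisks {Ω : Type*} [MeasurableSpace Ω] (P : Measure Ω) (k : UncertaintyKind)
    (ε : ℝ) (γ : ℝ → ℝ) (Z : Ω → ℝ) : Set ℝ :=
  (fun Y => innerL2 γ (quantile (P.map Y))) '' uncertaintySet P k ε Z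

/-- A Markov decision process with state space `S` and action space `A` over the periods
`0, …, T`, together with the data of a dynamic robust distortion risk measure: state-dependent
distortion densities `γ s` and tolerances `ε s`, and the kind of uncertainty sets. -/
structure RobustMDP (S A : Type*) [MeasurableSpace S] where
  /-- the last period -/
  T : ℕ
  /-- the cost `c(s, a, s')` -/
  cost : S → A → S → ℝ
  /-- the law of the next state given the current state and action -/
  transition : S → A → ProbabilityMeasure S
  /-- the distortion density -/
  γ : S → ℝ → ℝ
  /-- the tolerance -/
  ε : S → ℝ
  /-- the kind of uncertainty set -/
  kind : UncertaintyKind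

namespace RobustMDP

variable {S A : Type*} [MeasurableSpace S]

/-- The conditional law of one step of the process given `(s, a)`. An outcome is a pair `(s', u)`
of the next state and of an independent uniform variable, so that every law on the real line is
the law of some random variable of that step. -/
def stepLaw (M : RobustMDP S A) (s : S) (a : A) : Measure (S × unitInterval) :=
  (M.transition s a : Measure S).prod volume

/-- The cost-to-go `c(s, a, s') + q(s', π(s'))` when `q` is the Q-function of the next period. -/
def costToGo (M : RobustMDP S A) (π : S → A) (q : S → A → ℝ) (s : S) (a : A) :
    S × unitInterval → ℝ :=
  fun ω => M.cost s a ω.1 + q ω.1 (π ω.1)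

/-- The distortion risks, given `(s, a)`, over the uncertainty set of the cost-to-go. -/
def risksToGo (M : RobustMDP S A) (π : S → A) (q : S → A → ℝ) (s : S) (a : A) : Set ℝ :=
  distortionRisks (M.stepLaw s a) M.kind (M.ε s) (M.γ s) (M.costToGo π q s a)

/-- The Q-function with `n` periods to go. -/
def qToGo (M : RobustMDP S A) (π : S → A) : ℕ → S → A → ℝ
  | 0 => fun _ _ => 0
  | n + 1 => fun s a => sSup (M.risksToGo π (qToGo M π n) s a)

/-- The robust Q-function `Q_t(s, a; π)` at period `t`. -/
def Q (M : RobustMDP S A) (π : S → A) (t : ℕ) : S → A → ℝ :=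
  M.qToGo π (M.T + 1 - t)

/-- The terminal condition. -/
theorem Q_terminal (M : RobustMDP S A) (π : S → A) (s : S) (a : A) :
    M.Q π (M.T + 1) s a = 0 := by
  simp [Q, qToGo]

/-- The Bellman recursion. -/
theorem Q_eq (M : RobustMDP S A) (π : S → A) {t : ℕ} (ht : t ≤ M.T) (s : S) (a : A) :
    M.Q π t s a = sSup (M.risksToGo π (M.Q π (t + 1)) s a) := by
  have h : M.T + 1 - t = (M.T + 1 - (t + 1)) + 1 := by omega
  simp only [Q]
  rw [h]
  rfl

end RobustMDP

/-- The first coordinate of the states in `S` is the time, which takes the values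
`0, …, T + 1` and moves forward by one at every transition. -/
def RobustMDP.TimeAugmented {d : ℕ} {S : Set (Fin (d + 1) → ℝ)} {A : Type*}
    (M : RobustMDP S A) : Prop :=
  (∀ s : S, ∃ t : ℕ, t ≤ M.T + 1 ∧ s.1 0 = t) ∧
    ∀ (s : S) (a : A) (t : ℕ), t ≤ M.T → s.1 0 = t →
      ∀ᵐ s' ∂(M.transition s a : Measure S), s'.1 0 = ((t + 1 : ℕ) : ℝ)

end

/-! Each `Q_t` is continuous on the compact set `S × A`. Time is a continuous integer-valued
coordinate, hence locally constant, so the `Q_t` glue to one continuous function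
(`continuous_glue_of_time`), which a single network approximates.

Continuity goes by backward induction. If `Q_{t+1}` is continuous, the law of the cost-to-go is
weakly continuous in `(s, a)` with uniformly bounded support, so its quantile function is continuous
in `L²` (`tendsto_toL2_quantile`). The independent uniform variable realises every bounded monotone
function as a quantile function, so `Q_t` is the supremum of a linear functional over an ambiguity
set in the cone of monotone functions (`distortionRisks_eq`). This supremum is continuous in the
density, the tolerance and the centre, even at tolerance zero, because members of one ambiguity set
can be moved a small distance into a nearby one (`IsComonotoneCone.exists_mem_ambiguitySet`). Under
moment constraints the sets are not convex: the move takes place on a sphere and relies on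
comonotone functions being nonnegatively correlated (Chebyshev).

Approximation (`span_comp_dense`): the closed span of the `σ ∘ l` contains mollified versions of
`σ`, then their directional derivatives, hence all products of affine functions unless `σ` is a
polynomial; Stone–Weierstrass concludes. -/

/-! ### Density of ridge functions with a non-polynomial activation. -/

section UniversalApproximation

open Filter Topology Polynomial
open scoped ContDiff Convolution

/-- A smooth function whose `k`-th derivative vanishes is a polynomial of degree less than `k`. -/
theorem exists_polynomial_of_iteratedDeriv_eq_zero {f : ℝ → ℝ} (hf : ContDiff ℝ ∞ f) (k : ℕ)
    (hk : ∀ x, iteratedDeriv k f x = 0) : ∃ p : ℝ[X], p.degree < k ∧ ∀ x, f x = p.eval x := by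
  rcases k with _ | n
  · exact ⟨0, by simp, fun x => by simpa using hk x⟩
  -- The Taylor polynomial at 0: the Lagrange remainder contains the vanishing derivative.
  refine ⟨∑ i ∈ Finset.range (n + 1), C ((i.factorial : ℝ)⁻¹ * iteratedDeriv i f 0) * X ^ i,
    ?_, fun x => ?_⟩
  · rw [← mem_degreeLT]
    refine Submodule.sum_mem _ fun i hi => mem_degreeLT.2 ?_
    refine (degree_C_mul_X_pow_le i _).trans_lt ?_
    exact_mod_cast Finset.mem_range.1 hi
  · rw [eval_finsetSum]
    rcases eq_or_ne 0 x with rfl | hx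
    · rw [Finset.sum_range_succ']
      simp
    · obtain ⟨y, -, hy⟩ := taylor_mean_remainder_lagrange_iteratedDeriv (f := f) (n := n) hx
        (hf.of_le (by exact_mod_cast le_top)).contDiffOn
      rw [hk y, zero_mul, zero_div, sub_eq_zero, taylor_within_apply] at hy
      rw [hy]
      refine Finset.sum_congr rfl fun i _ => ?_
      rw [iteratedDerivWithin_eq_iteratedDeriv (uniqueDiffOn_uIcc hx)
        (hf.of_le (by exact_mod_cast le_top)).contDiffAt Set.left_mem_uIcc]
      simp
      ring

/-- A pointwise limit of polynomials of bounded degree is a polynomial. -/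
theorem exists_polynomial_of_tendsto {ι : Type*} {l : Filter ι} [l.NeBot] {f : ι → ℝ → ℝ}
    {g : ℝ → ℝ} (k : ℕ) (hf : ∀ i, ∃ p : ℝ[X], p.degree < k ∧ ∀ x, f i x = p.eval x)
    (hg : ∀ x, Tendsto (fun i => f i x) l (𝓝 (g x))) : ∃ p : ℝ[X], ∀ x, g x = p.eval x := by
  have hinj : Set.InjOn (fun j : ℕ => (j : ℝ)) (Finset.range k : Set ℕ) :=
    Nat.cast_injective.injOn
  -- Interpolation at `0, …, k - 1` reproduces each `f i` from finitely many values, an identity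
  -- that survives pointwise limits.
  refine ⟨Lagrange.interpolate (Finset.range k) (fun j : ℕ => (j : ℝ)) fun j => g j, fun x => ?_⟩
  refine tendsto_nhds_unique (hg x) ?_
  have h : ∀ i, f i x = ∑ j ∈ Finset.range k,
      f i j * (Lagrange.basis (Finset.range k) (fun j : ℕ => (j : ℝ)) j).eval x := by
    intro i
    obtain ⟨p, hp, hfp⟩ := hf i
    have := Lagrange.eq_interpolate hinj (f := p) (by simpa using hp)
    rw [hfp]
    conv_lhs => rw [this]
    simp [Lagrange.interpolate_apply, eval_finsetSum, hfp]
  simp only [h, Lagrange.interpolate_apply, eval_finsetSum, eval_mul, eval_C]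
  exact tendsto_finsetSum _ fun j _ => (hg j).mul_const _

variable {X : Type*} [TopologicalSpace X]

/-- A closed subspace that contains `g * F ∘ (l + w l')` for all `w` contains the derivative
`g * l' * F' ∘ l` at `w = 0`. -/
theorem mul_deriv_comp_mem {V : Submodule ℝ C(X, ℝ)} (hV : IsClosed (V : Set C(X, ℝ)))
    {F F' : C(ℝ, ℝ)} (hF : ∀ x, HasDerivAt F (F' x) x) (g l l' : C(X, ℝ))
    (h : ∀ w : ℝ, g * F.comp (l + w • l') ∈ V) : g * l' * F'.comp l ∈ V := by
  -- The difference quotient in `w`, written as an integral so that it extends continuously to `w =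
  -- 0`; currying turns joint continuity into continuity in `C(X, ℝ)`.
  let Φ : C(ℝ × X, ℝ) := ⟨fun p => g p.2 * l' p.2 *
    ∫ s in (0 : ℝ)..1, F' (l p.2 + s * (p.1 * l' p.2)), by
      refine Continuous.mul (by fun_prop) ?_
      exact intervalIntegral.continuous_parametric_intervalIntegral_of_continuous' (by fun_prop) _ _⟩
  have h0 : Φ.curry 0 = g * l' * F'.comp l := by
    ext x
    simp [Φ]
  rw [← h0]
  have hne : ∀ w : ℝ, w ≠ 0 → Φ.curry w ∈ V := by
    intro w hw
    have : Φ.curry w = w⁻¹ • (g * F.comp (l + w • l') - g * F.comp (l + (0 : ℝ) • l')) := by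
      ext x
      have hint : ∫ s in (0 : ℝ)..1, F' (l x + s * (w * l' x)) * (w * l' x)
          = F (l x + 1 * (w * l' x)) - F (l x + 0 * (w * l' x)) := by
        refine intervalIntegral.integral_eq_sub_of_hasDerivAt
          (f := fun s => F (l x + s * (w * l' x))) (fun s _ => ?_)
          (Continuous.intervalIntegrable (by fun_prop) _ _)
        refine (hF _).comp s ?_
        simpa using ((hasDerivAt_id s).mul_const (w * l' x)).const_add (l x)
      rw [intervalIntegral.integral_mul_const] at hint
      simp only [Φ, ContinuousMap.curry_apply, ContinuousMap.coe_mk, ContinuousMap.smul_apply,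
        ContinuousMap.sub_apply, ContinuousMap.mul_apply, ContinuousMap.comp_apply,
        ContinuousMap.add_apply, smul_eq_mul]
      simp only [one_mul, zero_mul] at hint ⊢
      rw [← mul_sub, ← hint]
      generalize (∫ s in (0 : ℝ)..1, F' (l x + s * (w * l' x))) = I
      field_simp
    rw [this]
    exact V.smul_mem _ (V.sub_mem (h w) (h 0))
  have hcont : Tendsto (fun w => Φ.curry w) (𝓝[≠] 0) (𝓝 (Φ.curry 0)) :=
    (Φ.curry.continuous.tendsto 0).mono_left nhdsWithin_le_nhds
  exact hV.mem_of_tendsto hcont (eventually_nhdsWithin_of_forall hne)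

/-- A closed subspace that contains `σ ∘ (l - t)` for all `t` contains `(φ ⋆ σ) ∘ l` for every
continuous `φ` with compact support. -/
theorem convolution_comp_mem [CompactSpace X] {V : Submodule ℝ C(X, ℝ)} (hV : IsClosed (V : Set C(X, ℝ)))
    {φ : ℝ → ℝ} (hφ : Continuous φ) (hφc : HasCompactSupport φ) {σ f : C(ℝ, ℝ)}
    (hf : ∀ x, f x = (φ ⋆[ContinuousLinearMap.lsmul ℝ ℝ, volume] σ) x) (l : C(X, ℝ))
    (h : ∀ t : ℝ, σ.comp (l - ContinuousMap.const X t) ∈ V) : f.comp l ∈ V := by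
  have : CompleteSpace V := hV.completeSpace_coe
  let Ψ : C(ℝ × X, ℝ) := ⟨fun p => σ (l p.2 - p.1), by fun_prop⟩
  have hΨ : ∀ t, Ψ.curry t = σ.comp (l - ContinuousMap.const X t) := fun t => rfl
  -- The convolution is the Bochner integral of this curve, which stays in the complete space `V`.
  let G : ℝ → V := fun t => φ t • ⟨Ψ.curry t, hΨ t ▸ h t⟩
  have hGc : Continuous G := hφ.smul (Continuous.subtype_mk Ψ.curry.continuous _)
  have hGs : HasCompactSupport G := hφc.smul_right
  have hGi : Integrable G := hGc.integrable_of_hasCompactSupport hGs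
  have : f.comp l = ((∫ t, G t : V) : C(X, ℝ)) := by
    ext x
    let E : V →L[ℝ] ℝ := (ContinuousMap.evalCLM ℝ x).comp V.subtypeL
    have hE : E (∫ t, G t) = ∫ t, E (G t) := 
      (ContinuousLinearMap.integral_comp_comm (𝕜 := ℝ) (L := E) (φ := G) hGi).symm
    change f (l x) = E (∫ t, G t)
    rw [hE, hf, convolution]
    rfl
  rw [this]
  exact Subtype.coe_prop _

/-- **Universal approximation**: if `σ` is continuous and not a polynomial and `D` is a space of
continuous functions on a compact space which contains the constants and separates points, then
the functions `σ ∘ l` with `l ∈ D` span a dense subspace. -/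
theorem span_comp_dense [CompactSpace X] (D : Submodule ℝ C(X, ℝ)) (hD1 : ∀ t : ℝ, ContinuousMap.const X t ∈ D)
    (hD : ∀ x y : X, x ≠ y → ∃ l ∈ D, l x ≠ l y) (σ : C(ℝ, ℝ))
    (hσ : ¬ ∃ p : ℝ[X], ∀ x, σ x = p.eval x) :
    (Submodule.span ℝ ((fun l => σ.comp l) '' (D : Set C(X, ℝ)))).topologicalClosure = ⊤ := by
  set V := (Submodule.span ℝ ((fun l => σ.comp l) '' (D : Set C(X, ℝ)))).topologicalClosure
    with hVdef
  have hV : IsClosed (V : Set C(X, ℝ)) := Submodule.isClosed_topologicalClosure _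
  have hσV : ∀ l ∈ D, σ.comp l ∈ V := fun l hl =>
    Submodule.le_topologicalClosure _ (Submodule.subset_span ⟨l, hl, rfl⟩)
  have hsmooth : ∀ b : ContDiffBump (0 : ℝ),
      ContDiff ℝ ∞ (b.normed volume ⋆[ContinuousLinearMap.lsmul ℝ ℝ, volume] σ) := fun b =>
    b.hasCompactSupport_normed.contDiff_convolution_left _ b.contDiff_normed
      σ.continuous.locallyIntegrable
  -- Each differentiation in a direction of `D` brings out one more factor.
  have hprod : ∀ (b : ContDiffBump (0 : ℝ)) (k : ℕ) (L : List C(X, ℝ)), (∀ l ∈ L, l ∈ D) →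
      L.length = k → ∀ (F : C(ℝ, ℝ)),
      (∀ x, F x = iteratedDeriv k
        (b.normed volume ⋆[ContinuousLinearMap.lsmul ℝ ℝ, volume] σ) x) →
      ∀ l ∈ D, L.prod * F.comp l ∈ V := by
    intro b k
    induction k with
    | zero =>
      intro L _ hL F hF l hl
      rw [List.length_eq_zero_iff.1 hL, List.prod_nil, one_mul]
      refine convolution_comp_mem hV b.continuous_normed b.hasCompactSupport_normed
        (fun x => by simpa using hF x) l fun t => hσV _ (D.sub_mem hl (hD1 t))
    | succ k ih =>
      intro L hLD hL F hF l hl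
      obtain ⟨l', L, rfl⟩ := List.exists_cons_of_length_eq_add_one hL
      have hd := hsmooth b
      let F₀ : C(ℝ, ℝ) := ⟨_, hd.continuous_iteratedDeriv k (by exact_mod_cast le_top)⟩
      rw [List.prod_cons, mul_comm l']
      refine mul_deriv_comp_mem hV (F := F₀) (fun x => ?_) _ _ _ fun w => ih L
        (fun l hl => hLD l (List.mem_cons_of_mem _ hl)) (by simpa using hL) F₀ (fun x => rfl) _
        (D.add_mem hl (D.smul_mem _ (hLD l' List.mem_cons_self)))
      rw [hF, iteratedDeriv_succ]
      exact ((hd.differentiable_iteratedDeriv k (by exact_mod_cast WithTop.coe_lt_top _)) x).hasDerivAt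
  have hmon : ∀ L : List C(X, ℝ), (∀ l ∈ L, l ∈ D) → L.prod ∈ V := by
    intro L hL
    obtain ⟨b, x, hbx⟩ : ∃ (b : ContDiffBump (0 : ℝ)) (x : ℝ), iteratedDeriv L.length
        (b.normed volume ⋆[ContinuousLinearMap.lsmul ℝ ℝ, volume] σ) x ≠ 0 := by
      -- Otherwise all mollifications are polynomials of degree below `L.length`, and so is their
      -- limit `σ`.
      by_contra! hzero
      refine hσ ?_
      let b : ℕ → ContDiffBump (0 : ℝ) := fun n =>
        ⟨1 / (n + 1) / 2, 1 / (n + 1), by positivity, half_lt_self (by positivity)⟩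
      exact exists_polynomial_of_tendsto (l := atTop) L.length
        (fun n => exists_polynomial_of_iteratedDeriv_eq_zero (hsmooth (b n)) _ (hzero (b n)))
        fun x => ContDiffBump.convolution_tendsto_right_of_continuous
          (φ := b) tendsto_one_div_add_atTop_nhds_zero_nat σ.continuous x
    let F : C(ℝ, ℝ) := ⟨_, (hsmooth b).continuous_iteratedDeriv L.length (by exact_mod_cast le_top)⟩
    -- Composing with the constant `x` makes the derivative factor a nonzero scalar, which can be
    -- divided out.
    have := hprod b _ L hL rfl F (fun _ => rfl) _ (hD1 x)
    have h2 : L.prod = (F x)⁻¹ • (L.prod * F.comp (ContinuousMap.const X x)) := by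
      ext y
      have : F x ≠ 0 := hbx
      simp
      field_simp
    rw [h2]
    exact V.smul_mem _ this
  have hA : (Algebra.adjoin ℝ (D : Set C(X, ℝ))).SeparatesPoints := by
    intro x y hxy
    obtain ⟨l, hl, h⟩ := hD x y hxy
    exact ⟨l, ⟨l, Algebra.subset_adjoin hl, rfl⟩, h⟩
  have hle : Subalgebra.toSubmodule (Algebra.adjoin ℝ (D : Set C(X, ℝ))) ≤ V := by
    rw [Algebra.adjoin_eq_span, Submodule.span_le]
    intro p hp
    obtain ⟨L, hL, rfl⟩ := Submonoid.exists_list_of_mem_closure hp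
    exact hmon L hL
  have htop := ContinuousMap.subalgebra_topologicalClosure_eq_top_of_separatesPoints _ hA
  rw [eq_top_iff]
  intro f _
  have hf : f ∈ (Algebra.adjoin ℝ (D : Set C(X, ℝ))).topologicalClosure := by
    rw [htop]
    trivial
  exact closure_minimal hle hV hf

end UniversalApproximation

/-! ### From ridge functions to one-hidden-layer networks. -/

section Networks

/-- Continuous functions on a compact set of pairs of vectors are uniformly approximated by
networks with a single hidden layer. -/
theorem exists_mlp_approx {n m : ℕ} {S : Set (Fin n → ℝ)} {A : Set (Fin m → ℝ)}
    (hS : IsCompact S) (hA : IsCompact A) {σ : ℝ → ℝ} (hσ : Continuous σ)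
    (hσ_poly : ¬ ∃ p : Polynomial ℝ, ∀ x, σ x = p.eval x) {f : S × A → ℝ} (hf : Continuous f)
    {ε : ℝ} (hε : 0 < ε) :
    ∃ N : MLP (n + m) 1, ∀ x : S × A, |f x - N.eval σ (Fin.append x.1.1 x.2.1) 0| < ε := by
  have := isCompact_iff_compactSpace.1 hS
  have := isCompact_iff_compactSpace.1 hA
  have happ : ∀ i, Continuous fun x : S × A => Fin.append x.1.1 x.2.1 i := by
    intro i
    refine Fin.addCases (fun j => ?_) (fun j => ?_) i
    · simp only [Fin.append_left]
      exact (continuous_apply j).comp (continuous_subtype_val.comp continuous_fst)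
    · simp only [Fin.append_right]
      exact (continuous_apply j).comp (continuous_subtype_val.comp continuous_snd)
  let coord : Fin (n + m) → C(S × A, ℝ) := fun i => ⟨_, happ i⟩
  let aff : (Fin (n + m) → ℝ) × ℝ →ₗ[ℝ] C(S × A, ℝ) :=
    (Fintype.linearCombination ℝ coord).coprod
      (LinearMap.toSpanSingleton ℝ _ (1 : C(S × A, ℝ)))
  have haff : ∀ w x, aff w x = (∑ i, w.1 i * Fin.append x.1.1 x.2.1 i) + w.2 := by
    intro w x
    simp [aff, coord, Fintype.linearCombination_apply, ContinuousMap.sum_apply]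
  have hdense := span_comp_dense (LinearMap.range aff)
    (fun t => ⟨(0, t), by ext x; simp [haff]⟩)
    (fun x y hxy => by
      by_contra! h
      have hi : ∀ i, Fin.append x.1.1 x.2.1 i = Fin.append y.1.1 y.2.1 i := fun i => by
        have := h _ ⟨(Pi.single i 1, 0), rfl⟩
        simpa [haff, Pi.single_apply] using this
      refine hxy (Prod.ext (Subtype.ext (funext fun j => ?_)) (Subtype.ext (funext fun j => ?_)))
      · simpa using hi (Fin.castAdd m j)
      · simpa using hi (Fin.natAdd n j)) ⟨σ, hσ⟩ hσ_poly
  have hfmem : (⟨f, hf⟩ : C(S × A, ℝ)) ∈ closure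
      (Submodule.span ℝ ((fun l => (⟨σ, hσ⟩ : C(ℝ, ℝ)).comp l) ''
        (LinearMap.range aff : Set C(S × A, ℝ))) : Set C(S × A, ℝ)) := by
    rw [← Submodule.topologicalClosure_coe, hdense]
    trivial
  obtain ⟨g, hg, hfg⟩ := Metric.mem_closure_iff.1 hfmem ε hε
  obtain ⟨h, c, u, rfl⟩ := Submodule.mem_span_set'.1 hg
  have hu : ∀ i, ∃ w, (⟨σ, hσ⟩ : C(ℝ, ℝ)).comp (aff w) = (u i : C(S × A, ℝ)) := by
    intro i
    obtain ⟨_, ⟨w, rfl⟩, hw⟩ := (u i).2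
    exact ⟨w, hw⟩
  choose w hw using hu
  refine ⟨.hidden (Matrix.of fun i => (w i).1) (fun i => (w i).2)
    (.output (Matrix.of fun _ i => c i) 0), fun x => ?_⟩
  have hx := (ContinuousMap.dist_lt_iff hε).1 hfg x
  rw [Real.dist_eq] at hx
  convert hx using 3
  · rfl
  simp only [MLP.eval, ContinuousMap.sum_apply, ContinuousMap.smul_apply, ← hw]
  simp [Matrix.mulVec, dotProduct, haff]

end Networks

/-! ### Stability of worst-case values over ambiguity sets in a Hilbert space. -/

section Ambiguity

open Filter Topology
open scoped RealInnerProductSpace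

variable {E : Type*} [NormedAddCommGroup E] [InnerProductSpace ℝ E]

/-- Two vectors on a sphere which form an acute angle can be interpolated on the sphere by a
nonnegative combination whose distance to the second one is prescribed. -/
theorem exists_sphere_interpolation {u v : E} {r ρ δ : ℝ} (hu : ‖u‖ = r) (hv : ‖v‖ = r)
    (huv : 0 ≤ ⟪u, v⟫) (hρ : ‖u - v‖ ≤ ρ) (hδ : 0 ≤ δ) :
    ∃ α β : ℝ, 0 ≤ α ∧ 0 ≤ β ∧ ‖α • u + β • v‖ = r ∧ ‖v - (α • u + β • v)‖ ≤ δ ∧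
      ‖α • u + β • v - u‖ ≤ Real.sqrt (ρ ^ 2 - δ ^ 2) := by
  rcases le_or_gt ρ δ with h | h
  · refine ⟨1, 0, zero_le_one, le_rfl, by simpa using hu, ?_, by simp⟩
    simpa [norm_sub_rev v u] using hρ.trans h
  have hρ0 : 0 < ρ := hδ.trans_lt h
  have hr0 : 0 ≤ r := hu ▸ norm_nonneg u
  rcases hr0.eq_or_lt with rfl | hr
  · rw [norm_eq_zero] at hu hv
    subst hu hv
    exact ⟨0, 0, le_rfl, le_rfl, by simp, by simpa using hδ, by simp⟩
  -- Take a point `p` of the chord and project it radially to the sphere. Without the rescaling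
  -- factor, the bounds on the squared distances to `v` and `u` are `b * ρ ^ 2` and `(1 - b) * ρ ^
  -- 2`, which dictates `b`. The factor `c` is at least 1 and, the angle being acute, only improves
  -- them.
  set b : ℝ := δ ^ 2 / ρ ^ 2 with hb
  have hb0 : 0 ≤ b := by positivity
  have hb1 : b ≤ 1 := (div_le_one (by positivity)).2 (by gcongr)
  have hbρ : b * ρ ^ 2 = δ ^ 2 := by rw [hb]; field_simp
  set a := ⟪u, v⟫ with ha
  set p := b • u + (1 - b) • v with hp
  have huu : ⟪u, u⟫ = r ^ 2 := by rw [real_inner_self_eq_norm_sq, hu]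
  have hvv : ⟪v, v⟫ = r ^ 2 := by rw [real_inner_self_eq_norm_sq, hv]
  have hpu : ⟪p, u⟫ = b * r ^ 2 + (1 - b) * a := by
    rw [hp, inner_add_left, real_inner_smul_left, real_inner_smul_left, huu, real_inner_comm]
  have hpv : ⟪p, v⟫ = b * a + (1 - b) * r ^ 2 := by
    rw [hp, inner_add_left, real_inner_smul_left, real_inner_smul_left, hvv]
  have hpp : ‖p‖ ^ 2 = (b ^ 2 + (1 - b) ^ 2) * r ^ 2 + 2 * (b * (1 - b) * a) := by
    rw [← real_inner_self_eq_norm_sq]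
    conv_lhs => rw [hp, inner_add_right, real_inner_smul_right, real_inner_smul_right, hpu, hpv]
    ring
  have h1b : 0 ≤ 1 - b := by linarith
  have hn0 : 0 < ‖p‖ := by
    have : 0 < ‖p‖ ^ 2 := by
      rw [hpp]
      have : 0 < b ^ 2 + (1 - b) ^ 2 := by nlinarith
      positivity
    exact (sq_pos_iff.1 this).lt_of_le' (norm_nonneg _)
  have hnr : ‖p‖ ≤ r := by
    calc ‖p‖ ≤ ‖b • u‖ + ‖(1 - b) • v‖ := norm_add_le _ _
      _ = r := by
        rw [norm_smul, norm_smul, hu, hv, Real.norm_of_nonneg hb0, Real.norm_of_nonneg h1b]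
        ring
  set c := r / ‖p‖ with hc
  have hc1 : 1 ≤ c := (one_le_div hn0).2 hnr
  have hc0 : 0 ≤ c := zero_le_one.trans hc1
  have hw : (c * b) • u + (c * (1 - b)) • v = c • p := by
    rw [hp, smul_add, smul_smul, smul_smul]
  have hnorm : ‖c • p‖ = r := by
    rw [norm_smul, Real.norm_of_nonneg hc0, hc, div_mul_cancel₀ _ hn0.ne']
  have hd : ‖u - v‖ ^ 2 = 2 * r ^ 2 - 2 * a := by
    rw [norm_sub_sq_real, hu, hv]
    ring
  have hd' : ‖u - v‖ ^ 2 ≤ ρ ^ 2 := by gcongr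
  refine ⟨c * b, c * (1 - b), by positivity, by positivity, ?_, ?_, ?_⟩
  · rw [hw, hnorm]
  · rw [hw]
    refine abs_le_of_sq_le_sq' ?_ hδ |>.2
    rw [norm_sub_sq_real, hnorm, hv, real_inner_smul_right, real_inner_comm, hpv]
    have : 0 ≤ b * a + (1 - b) * r ^ 2 := by positivity
    nlinarith
  · rw [hw]
    refine Real.le_sqrt_of_sq_le ?_
    rw [norm_sub_sq_real, hnorm, hu, real_inner_smul_left, hpu]
    have : 0 ≤ b * r ^ 2 + (1 - b) * a := by positivity
    nlinarith

/-- A convex cone which contains the line through a unit vector `e` and whose elements are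
pairwise nonnegatively correlated. -/
structure IsComonotoneCone (K : Set E) (e : E) : Prop where
  norm_eq_one : ‖e‖ = 1
  add_mem : ∀ f ∈ K, ∀ g ∈ K, f + g ∈ K
  smul_mem : ∀ c : ℝ, 0 ≤ c → ∀ f ∈ K, c • f ∈ K
  const_mem : ∀ c : ℝ, c • e ∈ K
  inner_mul_inner_le : ∀ f ∈ K, ∀ g ∈ K, ⟪f, e⟫ * ⟪g, e⟫ ≤ ⟪f, g⟫

/-- The elements of `K` at distance at most `ε` from `g` and, for the second kind, with the same
mean and norm as `g`. -/
def ambiguitySet (K : Set E) (e : E) (k : UncertaintyKind) (ε : ℝ) (g : E) : Set E :=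
  {h | h ∈ K ∧ ‖g - h‖ ≤ ε ∧
    match k with
    | .wasserstein => True
    | .wassersteinMoments => ⟪g, e⟫ = ⟪h, e⟫ ∧ ‖g‖ ^ 2 = ‖h‖ ^ 2}

theorem mem_ambiguitySet_self {K : Set E} {e : E} {k : UncertaintyKind} {ε : ℝ} {g : E}
    (hg : g ∈ K) (hε : 0 ≤ ε) : g ∈ ambiguitySet K e k ε g := by
  refine ⟨hg, by simpa using hε, ?_⟩
  cases k <;> simp

theorem norm_le_of_mem_ambiguitySet {K : Set E} {e : E} {k : UncertaintyKind} {ε : ℝ} {g h : E}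
    (hh : h ∈ ambiguitySet K e k ε g) : ‖h‖ ≤ ‖g‖ + ε := by
  have h1 : ‖h‖ ≤ ‖g‖ + ‖g - h‖ := by
    simpa using norm_sub_le g (g - h)
  linarith [hh.2.1]

/-- How far an element of an ambiguity set of tolerance `ε` has to be moved to get into the
ambiguity set of tolerance `ε'` of a centre at distance `d`. -/
noncomputable def transferModulus (d ε ε' : ℝ) : ℝ :=
  2 * d + Real.sqrt ((ε + 2 * d) ^ 2 - ε' ^ 2)

theorem norm_sub_inner_smul_le {e : E} (he : ‖e‖ = 1) (x : E) : ‖x - ⟪x, e⟫ • e‖ ≤ ‖x‖ := by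
  refine abs_le_of_sq_le_sq' ?_ (norm_nonneg _) |>.2
  rw [norm_sub_sq_real, real_inner_smul_right, norm_smul, he, mul_one, Real.norm_eq_abs, sq_abs]
  nlinarith [sq_nonneg ⟪x, e⟫]

theorem norm_sq_eq_add_inner_sq {e : E} (he : ‖e‖ = 1) (x : E) :
    ‖x - ⟪x, e⟫ • e‖ ^ 2 = ‖x‖ ^ 2 - ⟪x, e⟫ ^ 2 := by
  rw [norm_sub_sq_real, real_inner_smul_right, norm_smul, he, mul_one, Real.norm_eq_abs, sq_abs]
  ring

/-- For the ball, contract `h` towards the new centre. With moments, remove the means, rescale `h`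
to the norm of the centred `g'`, interpolate on that sphere towards the centred `g'`, and restore
the mean of `g'`. Correcting mean and norm costs `d` each, which gives the term `2 * d`. -/
theorem IsComonotoneCone.exists_mem_ambiguitySet {K : Set E} {e : E} (hK : IsComonotoneCone K e)
    {k : UncertaintyKind} {ε ε' : ℝ} {g g' h : E} (hε' : 0 ≤ ε') (hg' : g' ∈ K)
    (hh : h ∈ ambiguitySet K e k ε g) :
    ∃ h' ∈ ambiguitySet K e k ε' g', ‖h' - h‖ ≤ transferModulus ‖g - g'‖ ε ε' := by
  obtain ⟨hhK, hgh, hk⟩ := hh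
  set d := ‖g - g'‖ with hd
  have hd0 : 0 ≤ d := norm_nonneg _
  cases k with
  | wasserstein =>
    have hρ : ‖h - g'‖ ≤ ε + 2 * d := by
      have := norm_sub_le_norm_sub_add_norm_sub h g g'
      rw [norm_sub_rev h g] at this
      linarith
    rcases le_or_gt (ε + 2 * d) ε' with hle | hlt
    · refine ⟨h, ⟨hhK, ?_, trivial⟩, ?_⟩
      · rw [norm_sub_rev]
        exact hρ.trans hle
      · simp only [sub_self, norm_zero, transferModulus]
        positivity
    · set ρ := ε + 2 * d with hρdef
      have hρ0 : 0 < ρ := hε'.trans_lt hlt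
      set b := ε' / ρ with hb
      have hb0 : 0 ≤ b := by positivity
      have hb1 : b ≤ 1 := (div_le_one hρ0).2 hlt.le
      have hbρ : b * ρ = ε' := div_mul_cancel₀ _ hρ0.ne'
      refine ⟨b • h + (1 - b) • g', ⟨hK.add_mem _ (hK.smul_mem _ hb0 _ hhK) _
        (hK.smul_mem _ (by linarith) _ hg'), ?_, trivial⟩, ?_⟩
      · have : g' - (b • h + (1 - b) • g') = -(b • (h - g')) := by module
        rw [this, norm_neg, norm_smul, Real.norm_of_nonneg hb0, ← hbρ]
        gcongr
      · have : b • h + (1 - b) • g' - h = -((1 - b) • (h - g')) := by module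
        rw [this, norm_neg, norm_smul, Real.norm_of_nonneg (by linarith)]
        have h1 : (1 - b) * ‖h - g'‖ ≤ (1 - b) * ρ := by
          gcongr
        -- The left side is `ρ - ε'`, and `(ρ - ε') ^ 2 ≤ (ρ - ε') * (ρ + ε')`. The root is not
        -- sharp here but serves both kinds.
        have h2 : (1 - b) * ρ ≤ Real.sqrt (ρ ^ 2 - ε' ^ 2) := by
          refine Real.le_sqrt_of_sq_le ?_
          rw [sub_mul, hbρ]
          nlinarith
        rw [transferModulus]
        linarith
  | wassersteinMoments =>
    obtain ⟨hmean, hnorm⟩ := hk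
    have he := hK.norm_eq_one
    have hee : ⟪e, e⟫ = 1 := by rw [real_inner_self_eq_norm_sq, he, one_pow]
    set c := g - ⟪g, e⟫ • e with hc
    set c' := g' - ⟪g', e⟫ • e with hc'
    set h₀ := h - ⟪h, e⟫ • e with hh₀
    have hnc : ‖h₀‖ = ‖c‖ := by
      rw [← sq_eq_sq₀ (norm_nonneg _) (norm_nonneg _), hc, hh₀, norm_sq_eq_add_inner_sq he,
        norm_sq_eq_add_inner_sq he, hmean, hnorm]
    have hcc' : ‖c - c'‖ ≤ d := by
      have : c - c' = (g - g') - ⟪g - g', e⟫ • e := by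
        rw [hc, hc', inner_sub_left]
        module
      rw [this]
      exact norm_sub_inner_smul_le he _
    have hmm : |⟪g', e⟫ - ⟪g, e⟫| ≤ d := by
      rw [← inner_sub_left, hd, norm_sub_rev]
      simpa [he] using abs_real_inner_le_norm (g' - g) e
    rcases (norm_nonneg c).eq_or_lt with h0 | hpos
    -- A constant centre: the moments force `h = g`, and no rescaling is possible.
    · have hhg : h = g := by
        rw [← h0, norm_eq_zero] at hnc
        have h1 : c = 0 := norm_eq_zero.1 h0.symm
        rw [hh₀, ← hmean] at hnc
        rw [hc] at h1
        rw [sub_eq_zero.1 hnc, ← sub_eq_zero.1 h1]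
      refine ⟨g', mem_ambiguitySet_self hg' hε', ?_⟩
      rw [hhg, norm_sub_rev, ← hd, transferModulus]
      linarith [Real.sqrt_nonneg ((ε + 2 * d) ^ 2 - ε' ^ 2)]
    · set u := (‖c'‖ / ‖c‖) • h₀ with hu
      have hunorm : ‖u‖ = ‖c'‖ := by
        rw [hu, norm_smul, hnc, Real.norm_of_nonneg (by positivity), div_mul_cancel₀ _ hpos.ne']
      have huh : ‖u - h₀‖ ≤ d := by
        have h1 : u - h₀ = (‖c'‖ / ‖c‖ - 1) • h₀ := by rw [hu]; module
        have h2 : ‖u - h₀‖ = |‖c'‖ - ‖c‖| := by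
          rw [h1, norm_smul, hnc, Real.norm_eq_abs]
          nth_rewrite 2 [← abs_of_pos hpos]
          rw [← abs_mul, sub_mul, div_mul_cancel₀ _ hpos.ne', one_mul]
        rw [h2]
        refine (abs_norm_sub_norm_le _ _).trans ?_
        rwa [norm_sub_rev]
      have hhc : h₀ - c = h - g := by
        rw [hh₀, hc, hmean]
        module
      have huc : ‖u - c'‖ ≤ ε + 2 * d := by
        have h1 := norm_sub_le_norm_sub_add_norm_sub u h₀ c'
        have h2 := norm_sub_le_norm_sub_add_norm_sub h₀ c c'
        rw [hhc, norm_sub_rev h g] at h2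
        linarith
      -- Up to a nonnegative factor this is the covariance of `h` and `g'`.
      have hcor : 0 ≤ ⟪u, c'⟫ := by
        rw [hu, real_inner_smul_left]
        refine mul_nonneg (by positivity) ?_
        have h1 := hK.inner_mul_inner_le _ hhK _ hg'
        rw [hh₀, hc', inner_sub_left, inner_sub_right, inner_sub_right, real_inner_smul_left,
          real_inner_smul_left, real_inner_smul_right, real_inner_smul_right, hee,
          real_inner_comm g' e]
        linarith
      obtain ⟨α, β, hα, hβ, hw, hwv, hwu⟩ :=
        exists_sphere_interpolation hunorm rfl hcor huc hε'
      set w := α • u + β • c' with hwdef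
      have hwe : ⟪w, e⟫ = 0 := by
        rw [hwdef, hu, hc', hh₀, inner_add_left, real_inner_smul_left, real_inner_smul_left,
          real_inner_smul_left, inner_sub_left, inner_sub_left, real_inner_smul_left,
          real_inner_smul_left, hee]
        ring
      have hmean' : ⟪w + ⟪g', e⟫ • e, e⟫ = ⟪g', e⟫ := by
        rw [inner_add_left, hwe, real_inner_smul_left, hee]
        ring
      refine ⟨w + ⟪g', e⟫ • e, ⟨?_, ?_, ?_, ?_⟩, ?_⟩
      -- Nonnegative coefficients on `h` and `g'` keep the point in the cone; the coefficient of `e`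
      -- may have any sign.
      · have : w + ⟪g', e⟫ • e = (α * (‖c'‖ / ‖c‖)) • h + (β • g' +
            (⟪g', e⟫ - α * (‖c'‖ / ‖c‖) * ⟪h, e⟫ - β * ⟪g', e⟫) • e) := by
          rw [hwdef, hu, hc', hh₀]
          module
        rw [this]
        exact hK.add_mem _ (hK.smul_mem _ (by positivity) _ hhK) _
          (hK.add_mem _ (hK.smul_mem _ hβ _ hg') _ (hK.const_mem _))
      · have : g' - (w + ⟪g', e⟫ • e) = c' - w := by rw [hc']; module
        rwa [this]
      · exact hmean'.symm
      · have h1 := norm_sq_eq_add_inner_sq he g'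
        have h2 := norm_sq_eq_add_inner_sq he (w + ⟪g', e⟫ • e)
        rw [hmean', add_sub_cancel_right, hw] at h2
        rw [← hc'] at h1
        linarith
      · have h1 : w + ⟪g', e⟫ • e - h =
            (w - u) + ((u - h₀) + (⟪g', e⟫ - ⟪g, e⟫) • e) := by
          rw [hh₀, hmean]
          module
        have h2 := norm_add_le (w - u) ((u - h₀) + (⟪g', e⟫ - ⟪g, e⟫) • e)
        have h3 := norm_add_le (u - h₀) ((⟪g', e⟫ - ⟪g, e⟫) • e)
        rw [norm_smul, he, mul_one, Real.norm_eq_abs] at h3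
        rw [h1, transferModulus]
        linarith

theorem bddAbove_inner_ambiguitySet (K : Set E) (e : E) (k : UncertaintyKind) (ε : ℝ) (γ g : E) :
    BddAbove ((fun h => ⟪γ, h⟫) '' ambiguitySet K e k ε g) := by
  refine ⟨‖γ‖ * (‖g‖ + ε), ?_⟩
  rintro _ ⟨h, hh, rfl⟩
  exact (real_inner_le_norm _ _).trans (by gcongr; exact norm_le_of_mem_ambiguitySet hh)

/-- Move a competitor `h` to `h'` and split `⟪γ, h⟫` accordingly. The bound is one-sided; continuity
uses it in both directions. -/
theorem IsComonotoneCone.sSup_inner_le {K : Set E} {e : E} (hK : IsComonotoneCone K e)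
    {k : UncertaintyKind} {ε ε' : ℝ} {γ γ' g g' : E} (hε : 0 ≤ ε) (hε' : 0 ≤ ε') (hg : g ∈ K)
    (hg' : g' ∈ K) :
    sSup ((fun h => ⟪γ, h⟫) '' ambiguitySet K e k ε g) ≤
      sSup ((fun h => ⟪γ', h⟫) '' ambiguitySet K e k ε' g') +
        (‖γ - γ'‖ * (‖g‖ + ε) + ‖γ'‖ * transferModulus ‖g - g'‖ ε ε') := by
  refine csSup_le ⟨_, g, mem_ambiguitySet_self hg hε, rfl⟩ ?_
  rintro _ ⟨h, hh, rfl⟩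
  obtain ⟨h', hh', hle⟩ := hK.exists_mem_ambiguitySet hε' hg' hh
  have h1 := le_csSup (bddAbove_inner_ambiguitySet K e k ε' γ' g') ⟨h', hh', rfl⟩
  have h2 : ⟪γ, h⟫ = ⟪γ', h'⟫ + (⟪γ - γ', h⟫ + ⟪γ', h - h'⟫) := by
    rw [inner_sub_left, inner_sub_right]
    ring
  have h3 : ⟪γ - γ', h⟫ ≤ ‖γ - γ'‖ * (‖g‖ + ε) :=
    (real_inner_le_norm _ _).trans (by gcongr; exact norm_le_of_mem_ambiguitySet hh)
  have h4 : ⟪γ', h - h'⟫ ≤ ‖γ'‖ * transferModulus ‖g - g'‖ ε ε' :=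
    (real_inner_le_norm _ _).trans (by gcongr; rwa [norm_sub_rev])
  simp only at h1 ⊢
  linarith

/-- The worst-case value over an ambiguity set depends continuously on the data. -/
theorem IsComonotoneCone.tendsto_sSup_inner {K : Set E} {e : E} (hK : IsComonotoneCone K e)
    (k : UncertaintyKind) {ι : Type*} {l : Filter ι} {ε : ι → ℝ} {γ g : ι → E} {ε₀ : ℝ} {γ₀ g₀ : E}
    (hε : ∀ i, 0 ≤ ε i) (hε₀ : 0 ≤ ε₀) (hg : ∀ i, g i ∈ K) (hg₀ : g₀ ∈ K)
    (hεl : Tendsto ε l (𝓝 ε₀)) (hγl : Tendsto γ l (𝓝 γ₀)) (hgl : Tendsto g l (𝓝 g₀)) :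
    Tendsto (fun i => sSup ((fun h => ⟪γ i, h⟫) '' ambiguitySet K e k (ε i) (g i))) l
      (𝓝 (sSup ((fun h => ⟪γ₀, h⟫) '' ambiguitySet K e k ε₀ g₀))) := by
  have hup : Tendsto (fun i => sSup ((fun h => ⟪γ₀, h⟫) '' ambiguitySet K e k ε₀ g₀) +
      (‖γ i - γ₀‖ * (‖g i‖ + ε i) + ‖γ₀‖ * transferModulus ‖g i - g₀‖ (ε i) ε₀)) l
      (𝓝 (sSup ((fun h => ⟪γ₀, h⟫) '' ambiguitySet K e k ε₀ g₀) +
      (‖γ₀ - γ₀‖ * (‖g₀‖ + ε₀) + ‖γ₀‖ * transferModulus ‖g₀ - g₀‖ ε₀ ε₀))) := by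
    have h1 := (hγl.sub_const γ₀).norm
    have h2 := (hgl.sub_const g₀).norm
    exact ((h1.mul (hgl.norm.add hεl)).add (((h2.const_mul 2).add
      ((((hεl.add (h2.const_mul 2)).pow 2).sub_const _).sqrt)).const_mul _)).const_add _
  have hlow : Tendsto (fun i => sSup ((fun h => ⟪γ₀, h⟫) '' ambiguitySet K e k ε₀ g₀) -
      (‖γ₀ - γ i‖ * (‖g₀‖ + ε₀) + ‖γ i‖ * transferModulus ‖g₀ - g i‖ ε₀ (ε i))) l
      (𝓝 (sSup ((fun h => ⟪γ₀, h⟫) '' ambiguitySet K e k ε₀ g₀) -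
      (‖γ₀ - γ₀‖ * (‖g₀‖ + ε₀) + ‖γ₀‖ * transferModulus ‖g₀ - g₀‖ ε₀ ε₀))) := by
    have h1 := (hγl.const_sub γ₀).norm
    have h2 := (hgl.const_sub g₀).norm
    exact ((h1.mul_const _).add (hγl.norm.mul ((h2.const_mul 2).add
      (((((h2.const_mul 2).const_add ε₀).pow 2).sub (hεl.pow 2)).sqrt)))).const_sub _
  -- The modulus vanishes at `d = 0`, `ε = ε'`, so both bounds tend to the limiting supremum.
  simp only [transferModulus, sub_self, norm_zero, mul_zero, zero_mul, add_zero, Real.sqrt_zero,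
    sub_zero] at hup hlow
  refine tendsto_of_tendsto_of_tendsto_of_le_of_le hlow hup (fun i => ?_) fun i => ?_
  · have := hK.sSup_inner_le (k := k) (γ := γ₀) (γ' := γ i) hε₀ (hε i) hg₀ (hg i)
    simp only [transferModulus] at this ⊢
    linarith
  · exact hK.sSup_inner_le (hε i) hε₀ (hg i) hg₀

end Ambiguity

/-! ### Quantile functions of bounded laws. -/

section Quantile

open Filter Topology

theorem cdf_eq_one_of_bounded {ν : Measure ℝ} [IsProbabilityMeasure ν] {C : ℝ}
    (hν : ∀ᵐ x ∂ν, |x| ≤ C) : cdf ν C = 1 := by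
  rw [cdf_eq_real, measureReal_def, (prob_compl_eq_zero_iff measurableSet_Iic).1, ENNReal.toReal_one]
  exact measure_mono_null (fun x hx hx' => hx ((le_abs_self x).trans hx')) hν

theorem cdf_eq_zero_of_bounded {ν : Measure ℝ} [IsProbabilityMeasure ν] {C z : ℝ}
    (hν : ∀ᵐ x ∂ν, |x| ≤ C) (hz : z < -C) : cdf ν z = 0 := by
  rw [cdf_eq_real, measureReal_def, measure_mono_null (fun x hx hx' => ?_) hν, ENNReal.toReal_zero]
  have h1 : x ≤ z := hx
  have h2 := neg_abs_le x
  have h3 : |x| ≤ C := hx'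
  linarith

/-- Bounds from below the set whose infimum is the quantile. At `u = 0` that set is the whole line
and `sInf` is a default value, which is why the open interval is used. -/
theorem neg_le_of_le_cdf {ν : Measure ℝ} [IsProbabilityMeasure ν] {C u z : ℝ}
    (hν : ∀ᵐ x ∂ν, |x| ≤ C) (hu : 0 < u) (hz : u ≤ cdf ν z) : -C ≤ z := by
  by_contra! h
  rw [cdf_eq_zero_of_bounded hν h] at hz
  linarith

theorem abs_quantile_le {ν : Measure ℝ} [IsProbabilityMeasure ν] {C u : ℝ}
    (hν : ∀ᵐ x ∂ν, |x| ≤ C) (hu : u ∈ Set.Ioo (0 : ℝ) 1) : |quantile ν u| ≤ C := by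
  have hC : C ∈ {z : ℝ | u ≤ cdf ν z} := by
    rw [Set.mem_ofPred_eq, cdf_eq_one_of_bounded hν]
    exact hu.2.le
  exact abs_le.2 ⟨le_csInf ⟨C, hC⟩ fun z hz => neg_le_of_le_cdf hν hu.1 hz,
    csInf_le ⟨-C, fun z hz => neg_le_of_le_cdf hν hu.1 hz⟩ hC⟩

theorem monotoneOn_quantile {ν : Measure ℝ} [IsProbabilityMeasure ν] {C : ℝ}
    (hν : ∀ᵐ x ∂ν, |x| ≤ C) : MonotoneOn (quantile ν) (Set.Ioo (0 : ℝ) 1) := by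
  intro u hu v hv huv
  refine csInf_le_csInf ⟨-C, fun z hz => neg_le_of_le_cdf hν hu.1 hz⟩ ⟨C, ?_⟩
    fun z hz => huv.trans hz
  rw [Set.mem_ofPred_eq, cdf_eq_one_of_bounded hν]
  exact hv.2.le

/-- The quantile function of a law with bounded support is the restriction of a bounded monotone
function. -/
theorem exists_monotone_eqOn_quantile {ν : Measure ℝ} [IsProbabilityMeasure ν] {C : ℝ}
    (hν : ∀ᵐ x ∂ν, |x| ≤ C) : ∃ f : ℝ → ℝ, Monotone f ∧ (∀ u, |f u| ≤ C) ∧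
      Set.EqOn (quantile ν) f (Set.Ioo (0 : ℝ) 1) := by
  have hb : ∀ u ∈ Set.Ioo (0 : ℝ) 1, quantile ν u ∈ Set.Icc (-C) C := fun u hu =>
    abs_le.1 (abs_quantile_le hν hu)
  have hCC : -C ≤ C := by
    have := hb (1 / 2) ⟨by norm_num, by norm_num⟩
    exact this.1.trans this.2
  obtain ⟨g, hg, hgq⟩ := (monotoneOn_quantile hν).exists_monotone_extension
    ⟨-C, by rintro _ ⟨u, hu, rfl⟩; exact (hb u hu).1⟩
    ⟨C, by rintro _ ⟨u, hu, rfl⟩; exact (hb u hu).2⟩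
  -- The monotone extension is clamped to keep the bound outside `(0, 1)`.
  refine ⟨fun u => max (-C) (min C (g u)), fun u v huv => ?_, fun u => abs_le.2 ⟨le_max_left _ _,
    max_le hCC (min_le_left _ _)⟩, fun u hu => ?_⟩
  · exact max_le_max le_rfl (min_le_min le_rfl (hg huv))
  · have := hb u hu
    simp only [← hgq hu]
    rw [min_eq_right this.2, max_eq_right this.1]

/-- A monotone function of a uniform variable has this function as its quantile function. -/
theorem quantile_map_of_monotone {f : ℝ → ℝ} (hf : Monotone f) {u : ℝ}
    (hu : u ∈ Set.Ioo (0 : ℝ) 1) (hfu : ContinuousAt f u) :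
    quantile ((volume.restrict (Set.Icc (0 : ℝ) 1)).map f) u = f u := by
  have hprob : IsProbabilityMeasure ((volume.restrict (Set.Icc (0 : ℝ) 1))) := ⟨by simp⟩
  have := Measure.isProbabilityMeasure_map (μ := volume.restrict (Set.Icc (0 : ℝ) 1))
    hf.measurable.aemeasurable
  have hcdf : ∀ z, cdf ((volume.restrict (Set.Icc (0 : ℝ) 1)).map f) z =
      volume.real ({x | f x ≤ z} ∩ Set.Icc 0 1) := by
    intro z
    rw [cdf_eq_real, map_measureReal_apply hf.measurable measurableSet_Iic,
      measureReal_restrict_apply (hf.measurable measurableSet_Iic)]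
    rfl
  have hfin : ∀ s : Set ℝ, volume (s ∩ Set.Icc (0 : ℝ) 1) ≠ ⊤ := fun s =>
    measure_ne_top_of_subset Set.inter_subset_right (by simp)
  refine IsLeast.csInf_eq ⟨?_, fun z hz => ?_⟩
  · rw [Set.mem_ofPred_eq, hcdf]
    calc u = volume.real (Set.Icc 0 u) := by simp [Real.volume_real_Icc_of_le hu.1.le]
      _ ≤ volume.real ({x | f x ≤ f u} ∩ Set.Icc 0 1) :=
        measureReal_mono (fun x hx => ⟨hf hx.2, hx.1, hx.2.trans hu.2.le⟩) (hfin _)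
  · rw [Set.mem_ofPred_eq, hcdf] at hz
    -- If `f v > z`, monotonicity confines `{f ≤ z}` to `[0, v]`, of measure less than `u`.
    have hlt : ∀ v ∈ Set.Ioo 0 u, f v ≤ z := by
      intro v hv
      by_contra! h
      have h1 : volume.real ({x | f x ≤ z} ∩ Set.Icc 0 1) ≤ volume.real (Set.Icc 0 v) := by
        refine measureReal_mono (fun x hx => ⟨hx.2.1, ?_⟩) (by simp)
        by_contra! hvx
        exact (h.trans_le (hf hvx.le)).not_ge hx.1
      rw [Real.volume_real_Icc_of_le hv.1.le, sub_zero] at h1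
      exact (hz.trans h1).not_gt hv.2
    refine le_of_tendsto (hfu.tendsto.mono_left (nhdsWithin_le_nhds (s := Set.Iio u))) ?_
    filter_upwards [Ioo_mem_nhdsLT hu.1] with v hv using hlt v hv

theorem quantile_map_ae_eq_of_monotone {f : ℝ → ℝ} (hf : Monotone f) :
    quantile ((volume.restrict (Set.Icc (0 : ℝ) 1)).map f) =ᵐ[volume.restrict (Set.Ioc (0 : ℝ) 1)]
      f := by
  have h1 : ∀ᵐ u : ℝ, ContinuousAt f u := hf.countable_not_continuousAt.measure_zero volume
  rw [EventuallyEq, ← Measure.restrict_congr_set Ioo_ae_eq_Ioc]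
  filter_upwards [ae_restrict_of_ae h1, ae_restrict_mem measurableSet_Ioo] with u hu hu'
  exact quantile_map_of_monotone hf hu' hu

/-- Quantile functions converge at the points of continuity of the limit. -/
theorem tendsto_quantile {ι : Type*} {l : Filter ι} {ν : ι → ProbabilityMeasure ℝ}
    {ν₀ : ProbabilityMeasure ℝ} (hν : Tendsto ν l (𝓝 ν₀)) {C : ℝ}
    (hC : ∀ i, ∀ᵐ x ∂(ν i : Measure ℝ), |x| ≤ C) (hC₀ : ∀ᵐ x ∂(ν₀ : Measure ℝ), |x| ≤ C)
    {f : ℝ → ℝ} (hf : Set.EqOn (quantile ν₀) f (Set.Ioo (0 : ℝ) 1)) {u : ℝ}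
    (hu : u ∈ Set.Ioo (0 : ℝ) 1) (hfu : ContinuousAt f u) :
    Tendsto (fun i => quantile (ν i) u) l (𝓝 (quantile ν₀ u)) := by
  have hbdd : ∀ {ν : ProbabilityMeasure ℝ}, (∀ᵐ x ∂(ν : Measure ℝ), |x| ≤ C) →
      BddBelow {z : ℝ | u ≤ cdf (ν : Measure ℝ) z} := fun h =>
    ⟨-C, fun z hz => neg_le_of_le_cdf h hu.1 hz⟩
  refine tendsto_order.2 ⟨fun z hz => ?_, fun z hz => ?_⟩
  -- Lower bound: portmanteau for the closed half-line up to `z'`.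
  · obtain ⟨z', hz', hz'q⟩ := exists_between hz
    have h0 : cdf (ν₀ : Measure ℝ) z' < u := by
      by_contra! h
      exact hz'q.not_ge (csInf_le (hbdd hC₀) h)
    have h1 : limsup (fun i => (ν i : Measure ℝ) (Set.Iic z')) l < ENNReal.ofReal u := by
      refine (ProbabilityMeasure.limsup_measure_closed_le_of_tendsto hν isClosed_Iic).trans_lt ?_
      rw [← ofReal_cdf]
      exact (ENNReal.ofReal_lt_ofReal_iff hu.1).2 h0
    filter_upwards [eventually_lt_of_limsup_lt h1] with i hi
    rw [← ofReal_cdf, ENNReal.ofReal_lt_ofReal_iff hu.1] at hi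
    refine hz'.trans_le (le_csInf ⟨C, ?_⟩ fun y hy => ?_)
    · rw [Set.mem_ofPred_eq, cdf_eq_one_of_bounded (hC i)]
      exact hu.2.le
    · by_contra! h
      exact (hi.trans_le hy).not_ge (monotone_cdf _ h.le)
  -- Upper bound: continuity at `u` provides a level `v > u` whose quantile is still below `z`, so
  -- an open half-line has limiting mass strictly above `u`.
  · have hev : ∀ᶠ v in 𝓝[>] u, f v < z := by
      have : Tendsto f (𝓝[>] u) (𝓝 (f u)) := hfu.tendsto.mono_left nhdsWithin_le_nhds
      rw [hf hu] at hz
      exact this.eventually_lt_const hz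
    obtain ⟨v, hvz, hv⟩ := (hev.and (Ioo_mem_nhdsGT hu.2)).exists
    have hv01 : v ∈ Set.Ioo (0 : ℝ) 1 := ⟨hu.1.trans hv.1, hv.2⟩
    rw [← hf hv01] at hvz
    obtain ⟨y, hy, hyz⟩ := exists_lt_of_csInf_lt ⟨C, by
      rw [Set.mem_ofPred_eq, cdf_eq_one_of_bounded hC₀]
      exact hv.2.le⟩ hvz
    obtain ⟨z', hyz', hz'⟩ := exists_between hyz
    have h1 : ENNReal.ofReal u < liminf (fun i => (ν i : Measure ℝ) (Set.Iio z')) l := by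
      refine lt_of_lt_of_le ?_
        (ProbabilityMeasure.le_liminf_measure_open_of_tendsto hν isOpen_Iio)
      refine lt_of_lt_of_le ?_ (measure_mono (Set.Iic_subset_Iio.2 hyz'))
      rw [← ofReal_cdf]
      exact (ENNReal.ofReal_lt_ofReal_iff (hv01.1.trans_le hy)).2 (hv.1.trans_le hy)
    filter_upwards [eventually_lt_of_lt_liminf h1] with i hi
    refine lt_of_le_of_lt (csInf_le (hbdd (hC i)) ?_) hz'
    have h2 := hi.trans_le (measure_mono Set.Iio_subset_Iic_self)
    rw [← ofReal_cdf] at h2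
    exact (ENNReal.ofReal_lt_ofReal_iff'.1 h2).1.le

end Quantile

/-! ### Quantile functions in `L²` and the cone of monotone functions. -/

section SquareIntegrable

open Filter Topology
open scoped RealInnerProductSpace

/-- The class in `L²` of a function on the unit interval. -/
noncomputable def toL2 (f : ℝ → ℝ) : Lp ℝ 2 (volume.restrict (Set.Ioc (0 : ℝ) 1)) :=
  open Classical in if h : MemLp f 2 (volume.restrict (Set.Ioc (0 : ℝ) 1)) then h.toLp f else 0

variable {f g : ℝ → ℝ}

theorem coeFn_toL2 (hf : MemLp f 2 (volume.restrict (Set.Ioc (0 : ℝ) 1))) :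
    toL2 f =ᵐ[volume.restrict (Set.Ioc (0 : ℝ) 1)] f := by
  rw [toL2, dif_pos hf]
  exact hf.coeFn_toLp

theorem toL2_sub (hf : MemLp f 2 (volume.restrict (Set.Ioc (0 : ℝ) 1)))
    (hg : MemLp g 2 (volume.restrict (Set.Ioc (0 : ℝ) 1))) :
    toL2 (fun u => f u - g u) = toL2 f - toL2 g := by
  rw [toL2, toL2, toL2, dif_pos hf, dif_pos hg, ← MemLp.toLp_sub]
  exact dif_pos (hf.sub hg)

theorem inner_toL2 (hf : MemLp f 2 (volume.restrict (Set.Ioc (0 : ℝ) 1)))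
    (hg : MemLp g 2 (volume.restrict (Set.Ioc (0 : ℝ) 1))) : ⟪toL2 f, toL2 g⟫ = innerL2 f g := by
  rw [L2.inner_def, innerL2, intervalIntegral.integral_of_le zero_le_one]
  refine integral_congr_ae ?_
  filter_upwards [coeFn_toL2 hf, coeFn_toL2 hg] with u hu hu'
  rw [hu, hu']
  simp [mul_comm]

theorem norm_toL2 (hf : MemLp f 2 (volume.restrict (Set.Ioc (0 : ℝ) 1))) :
    ‖toL2 f‖ = normL2 f := by
  rw [normL2, ← inner_toL2 hf hf, real_inner_self_eq_norm_sq, Real.sqrt_sq (norm_nonneg _)]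

theorem norm_toL2_sub (hf : MemLp f 2 (volume.restrict (Set.Ioc (0 : ℝ) 1)))
    (hg : MemLp g 2 (volume.restrict (Set.Ioc (0 : ℝ) 1))) :
    ‖toL2 f - toL2 g‖ = normL2 (fun u => f u - g u) := by
  rw [← toL2_sub hf hg]
  exact norm_toL2 (hf.sub hg)

theorem Monotone.memLp_of_bounded {C : ℝ} (hf : Monotone f) (hC : ∀ u, |f u| ≤ C) :
    MemLp f 2 (volume.restrict (Set.Ioc (0 : ℝ) 1)) :=
  MemLp.of_bound hf.measurable.aestronglyMeasurable C (ae_of_all _ hC)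

theorem quantile_ae_eq_of_eqOn {ν : Measure ℝ} (h : Set.EqOn (quantile ν) f (Set.Ioo (0 : ℝ) 1)) :
    quantile ν =ᵐ[volume.restrict (Set.Ioc (0 : ℝ) 1)] f := by
  rw [EventuallyEq, ← Measure.restrict_congr_set Ioo_ae_eq_Ioc]
  filter_upwards [ae_restrict_mem measurableSet_Ioo] with u hu using h hu

theorem memLp_quantile {ν : Measure ℝ} [IsProbabilityMeasure ν] {C : ℝ}
    (hν : ∀ᵐ x ∂ν, |x| ≤ C) : MemLp (quantile ν) 2 (volume.restrict (Set.Ioc (0 : ℝ) 1)) := by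
  obtain ⟨f, hf, hfC, hqf⟩ := exists_monotone_eqOn_quantile hν
  exact (hf.memLp_of_bounded hfC).ae_eq (quantile_ae_eq_of_eqOn hqf).symm

/-- Weak convergence of laws with uniformly bounded support implies convergence of the quantile
functions in `L²`. -/
theorem tendsto_toL2_quantile {ι : Type*} {l : Filter ι} [l.IsCountablyGenerated]
    {ν : ι → ProbabilityMeasure ℝ} {ν₀ : ProbabilityMeasure ℝ} (hν : Tendsto ν l (𝓝 ν₀)) {C : ℝ}
    (hC : ∀ i, ∀ᵐ x ∂(ν i : Measure ℝ), |x| ≤ C) (hC₀ : ∀ᵐ x ∂(ν₀ : Measure ℝ), |x| ≤ C) :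
    Tendsto (fun i => toL2 (quantile (ν i))) l (𝓝 (toL2 (quantile ν₀))) := by
  obtain ⟨f, hf, hfC, hqf⟩ := exists_monotone_eqOn_quantile hC₀
  rw [tendsto_iff_norm_sub_tendsto_zero]
  simp only [fun i => norm_toL2_sub (memLp_quantile (hC i)) (memLp_quantile hC₀), normL2, innerL2]
  simp only [intervalIntegral.integral_of_le (zero_le_one (α := ℝ))]
  have hlim : Tendsto (fun i => ∫ u in Set.Ioc (0 : ℝ) 1, (quantile (ν i) u - quantile ν₀ u) *
      (quantile (ν i) u - quantile ν₀ u)) l (𝓝 (∫ u in Set.Ioc (0 : ℝ) 1, 0)) := by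
    refine tendsto_integral_filter_of_dominated_convergence (fun _ => (C + C) * (C + C)) ?_ ?_
      (integrable_const _) ?_
    · refine Eventually.of_forall fun i => ?_
      have := ((memLp_quantile (hC i)).sub (memLp_quantile hC₀)).1
      exact this.mul this
    · refine Eventually.of_forall fun i => ?_
      rw [← Measure.restrict_congr_set Ioo_ae_eq_Ioc]
      filter_upwards [ae_restrict_mem measurableSet_Ioo] with u hu
      have : |quantile (ν i) u - quantile ν₀ u| ≤ C + C :=
        (abs_sub _ _).trans (add_le_add (abs_quantile_le (hC i) hu) (abs_quantile_le hC₀ hu))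
      rw [norm_mul, Real.norm_eq_abs]
      exact mul_le_mul this this (abs_nonneg _) ((abs_nonneg _).trans this)
    -- A monotone function has countably many discontinuities, so the quantiles converge almost
    -- everywhere.
    · have h1 : ∀ᵐ u : ℝ, ContinuousAt f u := hf.countable_not_continuousAt.measure_zero volume
      rw [← Measure.restrict_congr_set Ioo_ae_eq_Ioc]
      filter_upwards [ae_restrict_of_ae h1, ae_restrict_mem measurableSet_Ioo] with u hu hu'
      have := (tendsto_quantile hν hC hC₀ hqf hu' hu).sub_const (quantile ν₀ u)
      simpa using this.mul this
  simpa using hlim.sqrt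

/-- The classes in `L²` of bounded monotone functions. -/
def monotoneCone : Set (Lp ℝ 2 (volume.restrict (Set.Ioc (0 : ℝ) 1))) :=
  {h | ∃ f : ℝ → ℝ, Monotone f ∧ (∃ C, ∀ u, |f u| ≤ C) ∧ toL2 f = h}

theorem toL2_congr (h : f =ᵐ[volume.restrict (Set.Ioc (0 : ℝ) 1)] g) : toL2 f = toL2 g := by
  by_cases hf : MemLp f 2 (volume.restrict (Set.Ioc (0 : ℝ) 1))
  · rw [toL2, toL2, dif_pos hf, dif_pos (hf.ae_eq h)]
    exact (MemLp.toLp_eq_toLp_iff _ _).2 h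
  · rw [toL2, toL2, dif_neg hf, dif_neg fun hg => hf (hg.ae_eq h.symm)]

theorem toL2_quantile_mem_monotoneCone {ν : Measure ℝ} [IsProbabilityMeasure ν] {C : ℝ}
    (hν : ∀ᵐ x ∂ν, |x| ≤ C) : toL2 (quantile ν) ∈ monotoneCone := by
  obtain ⟨f, hf, hfC, hqf⟩ := exists_monotone_eqOn_quantile hν
  exact ⟨f, hf, ⟨C, hfC⟩, (toL2_congr (quantile_ae_eq_of_eqOn hqf)).symm⟩

/-- **Chebyshev's integral inequality** for bounded monotone functions. -/
theorem innerL2_mul_innerL2_le {C D : ℝ} (hf : Monotone f) (hfC : ∀ u, |f u| ≤ C)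
    (hg : Monotone g) (hgD : ∀ u, |g u| ≤ D) : innerL2 f 1 * innerL2 g 1 ≤ innerL2 f g := by
  have hfi : IntervalIntegrable f volume 0 1 := hf.intervalIntegrable
  have hgi : IntervalIntegrable g volume 0 1 := hg.intervalIntegrable
  have hfgi : IntervalIntegrable (fun u => f u * g u) volume 0 1 := by
    rw [intervalIntegrable_iff_integrableOn_Ioc_of_le zero_le_one]
    exact (hf.memLp_of_bounded hfC).integrable_mul (hg.memLp_of_bounded hgD)
  simp only [innerL2, Pi.one_apply, mul_one]
  set F := ∫ u in (0 : ℝ)..1, f u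
  set G := ∫ u in (0 : ℝ)..1, g u
  set I := ∫ u in (0 : ℝ)..1, f u * g u
  -- Integrate `(f u - f v) * (g u - g v) ≥ 0` in `u`, then in `v`; the result is `2 * (I - F * G)`.
  have h1 : ∀ v, 0 ≤ I - f v * G - F * g v + f v * g v := by
    intro v
    have h2 : ∫ u in (0 : ℝ)..1, (f u * g u - f v * g u - f u * g v + f v * g v) =
        I - f v * G - F * g v + f v * g v := by
      rw [intervalIntegral.integral_add ((hfgi.sub (hgi.const_mul _)).sub (hfi.mul_const _))
          intervalIntegrable_const,
        intervalIntegral.integral_sub (hfgi.sub (hgi.const_mul _)) (hfi.mul_const _),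
        intervalIntegral.integral_sub hfgi (hgi.const_mul _),
        intervalIntegral.integral_const_mul, intervalIntegral.integral_mul_const]
      simp [F, G, I]
    rw [← h2]
    refine intervalIntegral.integral_nonneg zero_le_one fun u _ => ?_
    have : 0 ≤ (f u - f v) * (g u - g v) := by
      rcases le_total u v with h | h
      · exact mul_nonneg_of_nonpos_of_nonpos (sub_nonpos.2 (hf h)) (sub_nonpos.2 (hg h))
      · exact mul_nonneg (sub_nonneg.2 (hf h)) (sub_nonneg.2 (hg h))
    linarith
  have h3 : ∫ v in (0 : ℝ)..1, (I - f v * G - F * g v + f v * g v) = I - F * G - F * G + I := by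
    rw [intervalIntegral.integral_add ((intervalIntegrable_const.sub (hfi.mul_const _)).sub
        (hgi.const_mul _)) hfgi,
      intervalIntegral.integral_sub (intervalIntegrable_const.sub (hfi.mul_const _))
        (hgi.const_mul _),
      intervalIntegral.integral_sub intervalIntegrable_const (hfi.mul_const _),
      intervalIntegral.integral_const_mul, intervalIntegral.integral_mul_const]
    simp [F, G, I]
  have h4 := intervalIntegral.integral_nonneg (μ := volume) zero_le_one fun v _ => h1 v
  rw [h3] at h4
  linarith

theorem isComonotoneCone_monotoneCone : IsComonotoneCone monotoneCone (toL2 1) := by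
  have h1 : MemLp (1 : ℝ → ℝ) 2 (volume.restrict (Set.Ioc (0 : ℝ) 1)) :=
    monotone_const.memLp_of_bounded (C := 1) (f := 1) (fun u => by simp)
  refine ⟨?_, ?_, ?_, ?_, ?_⟩
  · rw [norm_toL2 h1, normL2, innerL2]
    simp
  · rintro _ ⟨f, hf, ⟨C, hC⟩, rfl⟩ _ ⟨g, hg, ⟨D, hD⟩, rfl⟩
    refine ⟨f + g, hf.add hg, ⟨C + D, fun u => (abs_add_le _ _).trans (add_le_add (hC u) (hD u))⟩, ?_⟩
    have hf' := hf.memLp_of_bounded hC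
    have hg' := hg.memLp_of_bounded hD
    rw [toL2, toL2, toL2, dif_pos hf', dif_pos hg', dif_pos (hf'.add hg')]
    rfl
  · rintro c hc _ ⟨f, hf, ⟨C, hC⟩, rfl⟩
    refine ⟨c • f, hf.const_smul hc, ⟨c * C, fun u => ?_⟩, ?_⟩
    · rw [Pi.smul_apply, smul_eq_mul, abs_mul, abs_of_nonneg hc]
      exact mul_le_mul_of_nonneg_left (hC u) hc
    · have hf' := hf.memLp_of_bounded hC
      rw [toL2, toL2, dif_pos hf', dif_pos (hf'.const_smul c)]
      rfl
  · intro c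
    refine ⟨c • 1, fun u v _ => le_rfl, ⟨|c|, fun u => by simp⟩, ?_⟩
    rw [toL2, toL2, dif_pos h1, dif_pos (h1.const_smul c)]
    rfl
  · rintro _ ⟨f, hf, ⟨C, hC⟩, rfl⟩ _ ⟨g, hg, ⟨D, hD⟩, rfl⟩
    have hf' := hf.memLp_of_bounded hC
    have hg' := hg.memLp_of_bounded hD
    rw [inner_toL2 hf' h1, inner_toL2 hg' h1, inner_toL2 hf' hg']
    exact innerL2_mul_innerL2_le hf hC hg hD

/-- On a space which carries an independent uniform variable, the distortion risks over the
uncertainty set only depend on the quantile function of the centre. -/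
theorem distortionRisks_eq {Ω : Type*} [MeasurableSpace Ω] (μ : Measure Ω)
    [IsProbabilityMeasure μ] (k : UncertaintyKind) (ε : ℝ) {γ : ℝ → ℝ}
    (hγ : MemLp γ 2 (volume.restrict (Set.Ioc (0 : ℝ) 1))) {Z : Ω × unitInterval → ℝ}
    (hZ : Measurable Z) {C : ℝ} (hC : ∀ ω, |Z ω| ≤ C) :
    distortionRisks (μ.prod (volume : Measure unitInterval)) k ε γ Z =
      (fun h => ⟪toL2 γ, h⟫) '' ambiguitySet monotoneCone (toL2 1) k ε
        (toL2 (quantile ((μ.prod (volume : Measure unitInterval)).map Z))) := by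
  set P := μ.prod (volume : Measure unitInterval) with hP
  have h1 : MemLp (1 : ℝ → ℝ) 2 (volume.restrict (Set.Ioc (0 : ℝ) 1)) :=
    monotone_const.memLp_of_bounded (C := 1) (f := 1) (fun u => by simp)
  have hprob : ∀ {Y : Ω × unitInterval → ℝ}, Measurable Y → IsProbabilityMeasure (P.map Y) :=
    fun hY => Measure.isProbabilityMeasure_map hY.aemeasurable
  have hbdd : ∀ {Y : Ω × unitInterval → ℝ}, Measurable Y → ∀ {C : ℝ}, (∀ ω, |Y ω| ≤ C) →
      ∀ᵐ x ∂(P.map Y), |x| ≤ C := fun hY C hC =>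
    (ae_map_iff hY.aemeasurable (measurableSet_le (by fun_prop) (by fun_prop))).2 (ae_of_all _ hC)
  have hmem : ∀ {Y : Ω × unitInterval → ℝ}, Measurable Y → ∀ {C : ℝ}, (∀ ω, |Y ω| ≤ C) →
      MemLp (quantile (P.map Y)) 2 (volume.restrict (Set.Ioc (0 : ℝ) 1)) := fun hY C hC => by
    have := hprob hY
    exact memLp_quantile (hbdd hY hC)
  -- For bounded measurable `Y`, membership depends only on its quantile function.
  have hiff : ∀ {Y : Ω × unitInterval → ℝ}, Measurable Y → ∀ {C : ℝ}, (∀ ω, |Y ω| ≤ C) →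
      (Y ∈ uncertaintySet P k ε Z ↔
        toL2 (quantile (P.map Y)) ∈ ambiguitySet monotoneCone (toL2 1) k ε
          (toL2 (quantile (P.map Z)))) := by
    intro Y hY D hD
    have := hprob hY
    have hq := hmem hY hD
    have hqZ := hmem hZ hC
    rw [uncertaintySet, ambiguitySet, Set.mem_ofPred_eq, Set.mem_ofPred_eq, norm_toL2_sub hqZ hq]
    have hcone := toL2_quantile_mem_monotoneCone (hbdd hY hD)
    cases k
    · simp only [and_true]
      exact ⟨fun h => ⟨hcone, h.2.2⟩, fun h => ⟨hY, ⟨D, hD⟩, h.2⟩⟩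
    · simp only [inner_toL2 hq h1, inner_toL2 hqZ h1, norm_toL2 hq, norm_toL2 hqZ]
      exact ⟨fun h => ⟨hcone, h.2.2⟩, fun h => ⟨hY, ⟨D, hD⟩, h.2⟩⟩
  ext x
  constructor
  · rintro ⟨Y, hY, rfl⟩
    obtain ⟨D, hD⟩ := hY.2.1
    exact ⟨_, (hiff hY.1 hD).1 hY, inner_toL2 hγ (hmem hY.1 hD)⟩
  · rintro ⟨h, hh, rfl⟩
    obtain ⟨f, hf, ⟨D, hD⟩, rfl⟩ := hh.1
    -- Any monotone `f` in the ambiguity set is realised by applying it to the uniform coordinate.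
    have hYm : Measurable fun ω : Ω × unitInterval => f ω.2 :=
      hf.measurable.comp (measurable_subtype_coe.comp measurable_snd)
    have hlaw : P.map (fun ω => f ω.2) = (volume.restrict (Set.Icc (0 : ℝ) 1)).map f := by
      have h2 : (fun ω : Ω × unitInterval => f ω.2) = f ∘ (Subtype.val ∘ Prod.snd) := rfl
      rw [h2, ← Measure.map_map hf.measurable (measurable_subtype_coe.comp measurable_snd),
        ← Measure.map_map measurable_subtype_coe measurable_snd, hP, Measure.map_snd_prod,
        measure_univ, one_smul, unitInterval.volume_def]
      congr 1
      exact map_comap_subtype_coe measurableSet_Icc _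
    have hq : toL2 (quantile (P.map fun ω => f ω.2)) = toL2 f := by
      rw [hlaw]
      exact toL2_congr (quantile_map_ae_eq_of_monotone hf)
    refine ⟨fun ω => f ω.2, (hiff hYm fun ω => hD _).2 (hq ▸ hh), ?_⟩
    simp only
    rw [← hq, inner_toL2 hγ (hmem hYm fun ω => hD _)]

end SquareIntegrable

/-! ### Continuity of the Bellman recursion and gluing over time. -/

section Dynamic

open Filter Topology
open scoped RealInnerProductSpace

/-- The integral of a continuous function depends jointly continuously on the function and on the
probability measure. -/
theorem tendsto_integral_of_tendsto {X ι : Type*} [TopologicalSpace X] [CompactSpace X]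
    [MeasurableSpace X] [OpensMeasurableSpace X] {l : Filter ι} {μ : ι → ProbabilityMeasure X}
    {μ₀ : ProbabilityMeasure X} (hμ : Tendsto μ l (𝓝 μ₀)) {G : ι → C(X, ℝ)} {G₀ : C(X, ℝ)}
    (hG : Tendsto G l (𝓝 G₀)) :
    Tendsto (fun i => ∫ x, G i x ∂(μ i : Measure X)) l (𝓝 (∫ x, G₀ x ∂(μ₀ : Measure X))) := by
  have hint : ∀ (g : C(X, ℝ)) (μ : ProbabilityMeasure X), Integrable g (μ : Measure X) :=
    fun g μ => BoundedContinuousFunction.integrable _ (BoundedContinuousFunction.mkOfCompact g)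
  have h1 := ProbabilityMeasure.tendsto_iff_forall_integral_tendsto.1 hμ
    (BoundedContinuousFunction.mkOfCompact G₀)
  -- The error from replacing `G i` by `G₀` is at most its sup norm, since `μ i` has mass one.
  have h2 : Tendsto (fun i => ∫ x, (G i - G₀) x ∂(μ i : Measure X)) l (𝓝 0) := by
    refine squeeze_zero_norm (fun i => ?_) (tendsto_iff_norm_sub_tendsto_zero.1 hG)
    refine (norm_integral_le_of_norm_le_const (ae_of_all _ (G i - G₀).norm_coe_le_norm)).trans ?_
    simp
  have h3 := h1.add h2
  rw [add_zero] at h3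
  refine h3.congr fun i => ?_
  simp only [BoundedContinuousFunction.mkOfCompact_apply, ContinuousMap.sub_apply]
  rw [integral_sub (hint _ _) (hint _ _)]
  ring

namespace RobustMDP

variable {S A : Type*} [TopologicalSpace S] [MeasurableSpace S] [TopologicalSpace A]

theorem measurable_costToGo [BorelSpace S] (M : RobustMDP S A)
    (hcost : Continuous fun p : S × A × S => M.cost p.1 p.2.1 p.2.2) {π : S → A}
    (hπ : Continuous π) {q : S → A → ℝ} (hq : Continuous fun p : S × A => q p.1 p.2)
    (s : S) (a : A) : Measurable (M.costToGo π q s a) := by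
  have h : Continuous fun s' : S => M.cost s a s' + q s' (π s') :=
    (hcost.comp (by fun_prop : Continuous fun s' : S => (s, a, s'))).add
      (hq.comp (by fun_prop : Continuous fun s' : S => (s', π s')))
  exact h.measurable.comp measurable_fst

theorem exists_abs_costToGo_le [CompactSpace S] [CompactSpace A] (M : RobustMDP S A)
    (hcost : Continuous fun p : S × A × S => M.cost p.1 p.2.1 p.2.2) {π : S → A}
    {q : S → A → ℝ} (hq : Continuous fun p : S × A => q p.1 p.2) :
    ∃ C, ∀ s a ω, |M.costToGo π q s a ω| ≤ C := by
  obtain ⟨C, hC⟩ := isCompact_univ.exists_bound_of_continuousOn hcost.continuousOn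
  obtain ⟨D, hD⟩ := isCompact_univ.exists_bound_of_continuousOn hq.continuousOn
  exact ⟨C + D, fun s a ω => (abs_add_le _ _).trans
    (add_le_add (hC (s, a, ω.1) trivial) (hD (ω.1, π ω.1) trivial))⟩

instance (M : RobustMDP S A) (s : S) (a : A) : IsProbabilityMeasure (M.stepLaw s a) := by
  rw [stepLaw]
  infer_instance

variable [CompactSpace S] [BorelSpace S]

/-- The law of the cost-to-go depends weakly continuously on the state and the action. -/
theorem continuous_law_costToGo (M : RobustMDP S A)
    (hcost : Continuous fun p : S × A × S => M.cost p.1 p.2.1 p.2.2)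
    (htransition : Continuous fun p : S × A => M.transition p.1 p.2) {π : S → A}
    (hπ : Continuous π) {q : S → A → ℝ} (hq : Continuous fun p : S × A => q p.1 p.2) :
    Continuous fun p : S × A =>
      ProbabilityMeasure.map ⟨M.stepLaw p.1 p.2, inferInstance⟩
        (M.measurable_costToGo hcost hπ hq p.1 p.2).aemeasurable := by
  let F : C((S × A) × S, ℝ) := ⟨fun x => M.cost x.1.1 x.1.2 x.2 + q x.2 (π x.2),
    (hcost.comp (by fun_prop : Continuous fun x : (S × A) × S => (x.1.1, x.1.2, x.2))).add
      (hq.comp (by fun_prop : Continuous fun x : (S × A) × S => (x.2, π x.2)))⟩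
  refine continuous_iff_continuousAt.2 fun p₀ => ?_
  refine ProbabilityMeasure.tendsto_iff_forall_integral_tendsto.2 fun φ => ?_
  -- Currying makes the integrand continuous in `(s, a)` for the sup norm; the uniform coordinate
  -- integrates out.
  let Ψ : C((S × A) × S, ℝ) := φ.toContinuousMap.comp F
  have h := tendsto_integral_of_tendsto (htransition.tendsto p₀) (Ψ.curry.continuous.tendsto p₀)
  have heq : ∀ p : S × A, ∫ x, φ x ∂((M.stepLaw p.1 p.2).map (M.costToGo π q p.1 p.2)) =
      ∫ s', Ψ.curry p s' ∂(M.transition p.1 p.2 : Measure S) := by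
    intro p
    rw [integral_map (M.measurable_costToGo hcost hπ hq p.1 p.2).aemeasurable
      φ.continuous.aestronglyMeasurable, stepLaw]
    have := integral_fun_fst (μ := (M.transition p.1 p.2 : Measure S))
      (ν := (volume : Measure unitInterval)) (fun s' => Ψ.curry p s')
    rw [probReal_univ, one_smul] at this
    exact this
  have h' : Tendsto (fun p : S × A => ∫ x, φ x ∂((M.stepLaw p.1 p.2).map
      (M.costToGo π q p.1 p.2))) (𝓝 p₀) (𝓝 (∫ x, φ x ∂((M.stepLaw p₀.1 p₀.2).map
      (M.costToGo π q p₀.1 p₀.2)))) := by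
    simpa only [heq] using h
  exact h'

variable [CompactSpace A]

theorem risksToGo_eq (M : RobustMDP S A)
    (hcost : Continuous fun p : S × A × S => M.cost p.1 p.2.1 p.2.2)
    (hγ : ∀ s, MemLp (M.γ s) 2 (volume.restrict (Set.Ioc (0 : ℝ) 1))) {π : S → A}
    (hπ : Continuous π) {q : S → A → ℝ} (hq : Continuous fun p : S × A => q p.1 p.2)
    (s : S) (a : A) : M.risksToGo π q s a =
      (fun h => ⟪toL2 (M.γ s), h⟫) '' ambiguitySet monotoneCone (toL2 1) M.kind (M.ε s)
        (toL2 (quantile ((M.stepLaw s a).map (M.costToGo π q s a)))) := by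
  obtain ⟨C, hC⟩ := M.exists_abs_costToGo_le hcost (π := π) hq
  exact distortionRisks_eq _ _ _ (hγ s) (M.measurable_costToGo hcost hπ hq s a) (hC s a)

theorem ae_abs_le_law_costToGo (M : RobustMDP S A)
    (hcost : Continuous fun p : S × A × S => M.cost p.1 p.2.1 p.2.2) {π : S → A}
    (hπ : Continuous π) {q : S → A → ℝ} (hq : Continuous fun p : S × A => q p.1 p.2) :
    ∃ C, ∀ s a, ∀ᵐ x ∂((M.stepLaw s a).map (M.costToGo π q s a)), |x| ≤ C := by
  obtain ⟨C, hC⟩ := M.exists_abs_costToGo_le hcost (π := π) hq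
  exact ⟨C, fun s a => (ae_map_iff (M.measurable_costToGo hcost hπ hq s a).aemeasurable
    (measurableSet_le (by fun_prop) (by fun_prop))).2 (ae_of_all _ (hC s a))⟩

/-- The cost-to-go lies in its own uncertainty set and Cauchy–Schwarz bounds the risks, so `sSup` is
a genuine supremum and not a default value. -/
theorem isLUB_risksToGo (M : RobustMDP S A)
    (hcost : Continuous fun p : S × A × S => M.cost p.1 p.2.1 p.2.2)
    (hγ : ∀ s, MemLp (M.γ s) 2 (volume.restrict (Set.Ioc (0 : ℝ) 1))) (hε : ∀ s, 0 ≤ M.ε s)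
    {π : S → A} (hπ : Continuous π) {q : S → A → ℝ}
    (hq : Continuous fun p : S × A => q p.1 p.2) (s : S) (a : A) :
    IsLUB (M.risksToGo π q s a) (sSup (M.risksToGo π q s a)) := by
  obtain ⟨C, hC⟩ := M.ae_abs_le_law_costToGo hcost hπ hq
  have := Measure.isProbabilityMeasure_map (μ := M.stepLaw s a)
    (M.measurable_costToGo hcost hπ hq s a).aemeasurable
  rw [M.risksToGo_eq hcost hγ hπ hq]
  exact isLUB_csSup
    ⟨_, _, mem_ambiguitySet_self (toL2_quantile_mem_monotoneCone (hC s a)) (hε s), rfl⟩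
    (bddAbove_inner_ambiguitySet _ _ _ _ _ _)

variable [FirstCountableTopology S] [FirstCountableTopology A]

/-- The induction step: weak continuity of the law gives `L²` continuity of the quantile function,
hence of the worst-case value. First countability serves the dominated convergence along
neighbourhood filters. -/
theorem continuous_sSup_risksToGo (M : RobustMDP S A)
    (hcost : Continuous fun p : S × A × S => M.cost p.1 p.2.1 p.2.2)
    (htransition : Continuous fun p : S × A => M.transition p.1 p.2)
    (hγ : ∀ s, MemLp (M.γ s) 2 (volume.restrict (Set.Ioc (0 : ℝ) 1)))
    (hγ_cont : ∀ s, Tendsto (fun s' => normL2 (fun u => M.γ s' u - M.γ s u)) (𝓝 s) (𝓝 0))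
    (hε : ∀ s, 0 ≤ M.ε s) (hε_cont : Continuous M.ε) {π : S → A} (hπ : Continuous π)
    {q : S → A → ℝ} (hq : Continuous fun p : S × A => q p.1 p.2) :
    Continuous fun p : S × A => sSup (M.risksToGo π q p.1 p.2) := by
  obtain ⟨C, hC⟩ := M.ae_abs_le_law_costToGo hcost hπ hq
  have hprob : ∀ s a, IsProbabilityMeasure ((M.stepLaw s a).map (M.costToGo π q s a)) :=
    fun s a => Measure.isProbabilityMeasure_map
      (M.measurable_costToGo hcost hπ hq s a).aemeasurable
  simp only [M.risksToGo_eq hcost hγ hπ hq]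
  refine continuous_iff_continuousAt.2 fun p₀ => ?_
  refine isComonotoneCone_monotoneCone.tendsto_sSup_inner M.kind (fun p => hε p.1) (hε p₀.1)
    (fun p => toL2_quantile_mem_monotoneCone (hC p.1 p.2))
    (toL2_quantile_mem_monotoneCone (hC p₀.1 p₀.2))
    ((hε_cont.comp continuous_fst).tendsto p₀) ?_ ?_
  · have h : Tendsto (fun s => toL2 (M.γ s)) (𝓝 p₀.1) (𝓝 (toL2 (M.γ p₀.1))) := by
      rw [tendsto_iff_norm_sub_tendsto_zero]
      simpa only [fun s => norm_toL2_sub (hγ s) (hγ p₀.1)] using hγ_cont p₀.1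
    exact h.comp continuous_fst.continuousAt
  · let ν : S × A → ProbabilityMeasure ℝ := fun p =>
      ProbabilityMeasure.map ⟨M.stepLaw p.1 p.2, inferInstance⟩
        (M.measurable_costToGo hcost hπ hq p.1 p.2).aemeasurable
    have hν : ∀ p, (ν p : Measure ℝ) = (M.stepLaw p.1 p.2).map (M.costToGo π q p.1 p.2) :=
      fun p => rfl
    have h : Tendsto ν (𝓝 p₀) (𝓝 (ν p₀)) := ((M.continuous_law_costToGo hcost htransition hπ hq).tendsto p₀)
    have h1 := tendsto_toL2_quantile h (C := C) (fun p => by rw [hν]; exact hC p.1 p.2)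
      (by rw [hν]; exact hC p₀.1 p₀.2)
    simpa only [hν] using h1

theorem continuous_qToGo (M : RobustMDP S A)
    (hcost : Continuous fun p : S × A × S => M.cost p.1 p.2.1 p.2.2)
    (htransition : Continuous fun p : S × A => M.transition p.1 p.2)
    (hγ : ∀ s, MemLp (M.γ s) 2 (volume.restrict (Set.Ioc (0 : ℝ) 1)))
    (hγ_cont : ∀ s, Tendsto (fun s' => normL2 (fun u => M.γ s' u - M.γ s u)) (𝓝 s) (𝓝 0))
    (hε : ∀ s, 0 ≤ M.ε s) (hε_cont : Continuous M.ε) {π : S → A} (hπ : Continuous π) (n : ℕ) :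
    Continuous fun p : S × A => M.qToGo π n p.1 p.2 := by
  induction n with
  | zero => exact continuous_const
  | succ n ih =>
    exact M.continuous_sSup_risksToGo hcost htransition hγ hγ_cont hε hε_cont hπ ih

end RobustMDP

/-- A family of continuous functions can be glued along a continuous integer-valued time. -/
theorem continuous_glue_of_time {X : Type*} [TopologicalSpace X] {τ : X → ℝ} (hτ : Continuous τ)
    (hτ_nat : ∀ x, ∃ t : ℕ, τ x = t) {f : ℕ → X → ℝ} (hf : ∀ t, Continuous (f t)) :
    Continuous fun x => f ⌊τ x⌋₊ x := by
  refine continuous_iff_continuousAt.2 fun x => ?_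
  -- Naturals at distance less than one coincide, so the index is locally constant.
  have hev : ∀ᶠ y in 𝓝 x, f ⌊τ x⌋₊ y = f ⌊τ y⌋₊ y := by
    obtain ⟨t, ht⟩ := hτ_nat x
    have := Metric.tendsto_nhds.1 (hτ.tendsto x) 1 one_pos
    filter_upwards [this] with y hy
    obtain ⟨t', ht'⟩ := hτ_nat y
    rw [ht, ht', Nat.dist_cast_real] at hy
    rw [ht, ht', Nat.floor_natCast, Nat.floor_natCast, Nat.pairwise_one_le_dist.eq hy.not_ge]
  exact ((hf _).continuousAt).congr hev

end Dynamic

theorem mainTheorem6 {d m : ℕ} (S : Set (Fin (d + 1) → ℝ)) (A : Set (Fin m → ℝ))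
    (hS : IsCompact S) (hA : IsCompact A)
    (M : RobustMDP S A) (htime : M.TimeAugmented)
    (hcost : Continuous fun p : S × A × S => M.cost p.1 p.2.1 p.2.2)
    (htransition : Continuous fun p : S × A => M.transition p.1 p.2)
    (hγ : ∀ s, IsDistortionDensity (M.γ s))
    (hγ_cont : ∀ s, Filter.Tendsto (fun s' => normL2 (fun u => M.γ s' u - M.γ s u))
      (nhds s) (nhds 0))
    (hε : ∀ s, 0 ≤ M.ε s) (hε_cont : Continuous M.ε)
    (π : S → A) (hπ : Continuous π)
    (σ : ℝ → ℝ) (hσ : Continuous σ) (hσ_poly : ¬ ∃ p : Polynomial ℝ, ∀ x, σ x = p.eval x) :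
    (∀ t ≤ M.T, ∀ (s : S) (a : A), IsLUB (M.risksToGo π (M.Q π (t + 1)) s a) (M.Q π t s a)) ∧
    ∀ ε : ℝ, 0 < ε → ∃ Qψ : MLP (d + 1 + m) 1, ∀ t ≤ M.T,
      (⨆ (s : S) (_ : s.1 0 = t) (a : A),
        ‖M.Q π t s a - Qψ.eval σ (Fin.append s.1 a.1) 0‖ₑ) < ENNReal.ofReal ε := by
  have := isCompact_iff_compactSpace.1 hS
  have := isCompact_iff_compactSpace.1 hA
  have hγ' : ∀ s, MemLp (M.γ s) 2 (volume.restrict (Set.Ioc (0 : ℝ) 1)) := fun s =>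
    (hγ s).1.mono_measure (Measure.restrict_mono Set.Ioc_subset_Icc_self le_rfl)
  -- This includes `t > M.T`, where truncated subtraction makes `Q` zero; gluing needs every index.
  have hQ : ∀ t, Continuous fun p : S × A => M.Q π t p.1 p.2 := fun t =>
    M.continuous_qToGo hcost htransition hγ' hγ_cont hε hε_cont hπ _
  refine ⟨fun t ht s a => ?_, fun ε hε₀ => ?_⟩
  · rw [M.Q_eq π ht]
    exact M.isLUB_risksToGo hcost hγ' hε hπ (hQ (t + 1)) s a
  · have hτ : Continuous fun p : S × A => p.1.1 0 :=
      (continuous_apply 0).comp (continuous_subtype_val.comp continuous_fst)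
    have hglue := continuous_glue_of_time hτ (fun p => by
      obtain ⟨t, -, ht⟩ := htime.1 p.1
      exact ⟨t, ht⟩) hQ
    -- Half of `ε`, because a supremum of strict inequalities yields only a weak one.
    obtain ⟨N, hN⟩ := exists_mlp_approx hS hA hσ hσ_poly hglue (half_pos hε₀)
    refine ⟨N, fun t _ => lt_of_le_of_lt (iSup_le fun s => iSup_le fun hs => iSup_le fun a => ?_)
      ((ENNReal.ofReal_lt_ofReal_iff hε₀).2 (half_lt_self hε₀))⟩
    have h := hN (s, a)
    simp only [hs, Nat.floor_natCast] at h
    rw [Real.enorm_eq_ofReal_abs]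
    exact ENNReal.ofReal_le_ofReal h.le
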